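/- Let $a>b>0$ and $\lambda\in\mathbb R$, $p^2=a^2+b^2$, $r^2=a^2-b^2$. Let $\mathcal P^6\subset\mathbb R^9(\omega,\alpha,\beta)$ be given by $\alpha\cdot\alpha=a^2$, $\beta\cdot\beta=b^2$, $\alpha\cdot\beta=0$, and put $M=(2\omega_1,2\omega_2,\omega_3+\lambda)$. The Hamiltonian field of a function $F$ is given by the Lie–Poisson bracket: $\dot M=M\times F_M+\alpha\times F_\alpha+\beta\times F_\beta$, $\dot\alpha=\alpha\times F_M$, $\dot\beta=\beta\times F_M$. Consider the integrals in involution of the Kowalevski gyrostat in a double field $$H=\omega_1^2+\omega_2^2+\tfrac12\omega_3^2-\alpha_1-\beta_2,$$ $$K=(\omega_1^2-\omega_2^2+\alpha_1-\beta_2)^2+(2\omega_1\omega_2+\alpha_2+\beta_1)^2+2\lambda[(\omega_3-\lambda)(\omega_1^2+\omega_2^2)+2\omega_1\alpha_3+2\omega_2\beta_3],$$ $$G=\tfrac14[(M\cdot\alpha)^2+(M\cdot\beta)^2]+\tfrac12(\omega_3-\lambda)\,M\cdot(\alpha\times\beta)-b^2\alpha_1-a^2\beta_2,$$ and the integral map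 $J=(H,K,G):\mathcal P^6\to\mathbb R^3(h,k,g)$. The rank of a point is the rank of $dJ$ on $T\mathcal P^6$. If $x$ is a point of rank $2$ and $F$ is a linear combination of $H,K,G$ with $dF(x)=0$ on $T_x\mathcal P^6$, let $A_F$ be the linearization of the Hamiltonian field of $F$ on $T_x\mathcal P^6$; when its characteristic polynomial is $\mu^4(\mu^2-C_F)$, $C_F$ is called the squared characteristic exponent of $F$. The point $x$ is of type "center" if some such $F$ has $C_F<0$, of type "saddle" if some such $F$ has $C_F>0$, and degenerate if no such $F$ has $C_F\ne0$. Consider the surfaces with parameters $(s,h)$, $s\neq0$, $$\Pi_1:\ k=p^2+\left(h-\tfrac{\lambda^2}2\right)^2-4\left(h-\tfrac{\lambda^2}2\right)s+3s^2-\frac{p^4-r^4}{4s^2},\quad g=\left(h-\tfrac{\lambda^2}2-s\right)s^2+\frac{p^4-r^4}{4s};$$ $$\Pi_2:\ k=-2\lambda^2\left(h-\tfrac{\lambda^2}2-2s\right)-\lambda^4+\frac{r^4}{4s^2},\quad g=\tfrac12p^2\left(h+\tfrac{\lambda^2}2\right)-\lambda^2s^2-\frac{r^4}{4s}.$$ Put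 $x_{1,2}=(\alpha_1-\beta_2)\pm i(\alpha_2+\beta_1)$, $y_{1,2}=(\alpha_1+\beta_2)\pm i(\alpha_2-\beta_1)$, $z_{1,2}=\alpha_3\pm i\beta_3$, $w_{1,2}=\omega_1\pm i\omega_2$, $w_3=\omega_3$, $N=x_2z_1w_1+x_1z_2w_2+z_1z_2(w_3+\lambda)$, $D=w_1w_2(w_3-\lambda)$. The critical subsystem $\mathcal M_1$ is the closure of the set $\mathcal M_1^0$ of points of $\mathcal P^6$ at which $D\ne0$ and $$y_1=-\frac1D\{w_1(w_3-\lambda)[x_2w_1+z_2(w_3+\lambda)]+N\},\qquad y_2=-\frac1D\{w_2(w_3-\lambda)[x_1w_2+z_1(w_3+\lambda)]+N\}.$$ **Theorem.** Let $x\in\mathcal M_1$ be a critical point of $J$ of rank $2$, and let $h=H(x)$. The function $S_1=N/(2D)$ on $\mathcal M_1^0$ has a limit $s\in\mathbb R\setminus\{0\}$ at $x$, and $J(x)$ is the point of $\Pi_1$ with parameters $(s,h)$. Put $$\mu^2=\frac1{2s}\left[12s^4-8\left(h-\tfrac{\lambda^2}2\right)s^3+p^4-r^4\right]\left[2s^2-2\left(h+\tfrac{\lambda^2}2\right)s+p^2\right].$$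 Then $\mu^2$ is the squared characteristic exponent at $x$ of a linear combination of $H,K,G$ that is critical at $x$ and has coefficient $2$ at $G$. The point $x$ is of type "center" if and only if $\mu^2<0$, of type "saddle" if and only if $\mu^2>0$, and degenerate if and only if $\mu^2=0$. On $\Pi_1$, the set $\mu^2=0$ is the union of the cuspidal edge of $\Pi_1$ and the curve of tangency of $\Pi_1$ with $\Pi_2$; thus $x$ is degenerate if and only if $(s,h)$ belongs to this union. Here both curves are taken in the parameter plane $(s,h)$, $s\ne0$: the cuspidal edge consists of the points at which the section of $\Pi_1$ by the plane $h=\mathrm{const}$ has an ordinary (semicubical) cusp, and the tangency curve of the points at which $\Pi_1$ and $\Pi_2$ meet, are both regular, and have the same tangent plane; each curve is taken with its limit points. -/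

import Mathlib

open scoped Matrix Topology

noncomputable section

namespace KowalevskiGyrostat

/-- The space `ℝ⁹` of triples `(ω, α, β)`; the components `1, 2, 3` of a vector are indexed by
`0, 1, 2`. -/
abbrev State : Type := (Fin 3 → ℝ) × (Fin 3 → ℝ) × (Fin 3 → ℝ)

/-- Angular velocity. -/
def om (x : State) : Fin 3 → ℝ := x.1

/-- First force vector. -/
def al (x : State) : Fin 3 → ℝ := x.2.1

/-- Second force vector. -/
def be (x : State) : Fin 3 → ℝ := x.2.2

/-! ### Phase space -/

/-- The geometric integrals `(α·α, β·β, α·β)`. -/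
def geom (x : State) : ℝ × ℝ × ℝ := (al x ⬝ᵥ al x, be x ⬝ᵥ be x, al x ⬝ᵥ be x)

/-- The phase space `P⁶`. -/
def phaseSpace (a b : ℝ) : Set State := {x | geom x = (a ^ 2, b ^ 2, 0)}

/-- The tangent space at `x` of the level set of the geometric integrals through `x`. -/
def tangent (x : State) : Submodule ℝ State := LinearMap.ker (fderiv ℝ geom x : State →ₗ[ℝ] ℝ × ℝ × ℝ)

/-! ### First integrals -/

/-- The energy integral. -/
def H (x : State) : ℝ :=
  om x 0 ^ 2 + om x 1 ^ 2 + om x 2 ^ 2 / 2 - al x 0 - be x 1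

/-- The integral `K`. -/
def K (lam : ℝ) (x : State) : ℝ :=
  (om x 0 ^ 2 - om x 1 ^ 2 + al x 0 - be x 1) ^ 2
    + (2 * om x 0 * om x 1 + al x 1 + be x 0) ^ 2
    + 2 * lam * ((om x 2 - lam) * (om x 0 ^ 2 + om x 1 ^ 2)
        + 2 * om x 0 * al x 2 + 2 * om x 1 * be x 2)

/-- The kinetic momentum `(2ω₁, 2ω₂, ω₃ + λ)`. -/
def momentum (lam : ℝ) (x : State) : Fin 3 → ℝ := ![2 * om x 0, 2 * om x 1, om x 2 + lam]

/-- The integral `G`, with `M_α = M·α`, `M_β = M·β`, `M_γ = M·(α × β)`. -/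
def G (a b lam : ℝ) (x : State) : ℝ :=
  ((momentum lam x ⬝ᵥ al x) ^ 2 + (momentum lam x ⬝ᵥ be x) ^ 2) / 4
    + (om x 2 - lam) * (momentum lam x ⬝ᵥ (al x ⨯₃ be x)) / 2
    - b ^ 2 * al x 0 - a ^ 2 * be x 1

/-- The integral map `J = H × K × G`. -/
def J (a b lam : ℝ) (x : State) : ℝ × ℝ × ℝ := (H x, K lam x, G a b lam x)

/-- The rank at `x` of the restriction of `J` to the phase space. -/
def rank (a b lam : ℝ) (x : State) : ℕ :=
  Module.finrank ℝ ((tangent x).map (fderiv ℝ (J a b lam) x : State →ₗ[ℝ] ℝ × ℝ × ℝ))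

/-- The linear combination `cH H + cK K + cG G`. -/
def integral (a b lam cH cK cG : ℝ) (x : State) : ℝ :=
  cH * H x + cK * K lam x + cG * G a b lam x

/-! ### Hamiltonian fields

The Lie-Poisson bracket in the variables `(M, α, β)`, `M = (2ω₁, 2ω₂, ω₃ + λ)`, for which the
geometric integrals are Casimir functions: the field of `F` is
`M' = M × F_M + α × F_α + β × F_β`, `α' = α × F_M`, `β' = β × F_M`.
For `F = H` it is the Euler-Poisson system of the gyrostat. -/

/-- The gradient of `F` in `M`, expressed by the derivatives in `ω`. -/
def gradM (F : State → ℝ) (x : State) : Fin 3 → ℝ :=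
  ![fderiv ℝ F x (Pi.single 0 1, 0, 0) / 2, fderiv ℝ F x (Pi.single 1 1, 0, 0) / 2,
    fderiv ℝ F x (Pi.single 2 1, 0, 0)]

/-- The gradient of `F` in `α`. -/
def gradAl (F : State → ℝ) (x : State) : Fin 3 → ℝ :=
  fun i => fderiv ℝ F x (0, Pi.single i 1, 0)

/-- The gradient of `F` in `β`. -/
def gradBe (F : State → ℝ) (x : State) : Fin 3 → ℝ :=
  fun i => fderiv ℝ F x (0, 0, Pi.single i 1)

/-- `M'` along the Hamiltonian field of `F`. -/
def momentumRate (lam : ℝ) (F : State → ℝ) (x : State) : Fin 3 → ℝ :=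
  momentum lam x ⨯₃ gradM F x + al x ⨯₃ gradAl F x + be x ⨯₃ gradBe F x

/-- The Hamiltonian field of `F` in the coordinates `(ω, α, β)`. -/
def sgrad (lam : ℝ) (F : State → ℝ) (x : State) : State :=
  (![momentumRate lam F x 0 / 2, momentumRate lam F x 1 / 2, momentumRate lam F x 2],
    al x ⨯₃ gradM F x, be x ⨯₃ gradM F x)

/-! ### Types of critical points of rank 2 -/

/-- `dF = 0` at `x` on the phase space, and the linearization `A` of the Hamiltonian field of `F`
on the six-dimensional tangent space at `x` has characteristic polynomial `μ⁴ (μ² - c)`. -/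
def HasSquaredExponent (lam : ℝ) (F : State → ℝ) (x : State) (c : ℝ) : Prop :=
  (∀ v ∈ tangent x, fderiv ℝ F x v = 0) ∧
    ∃ A : tangent x →ₗ[ℝ] tangent x,
      (∀ v : tangent x, (A v : State) = fderiv ℝ (sgrad lam F) x v) ∧
      A.charpoly = Polynomial.X ^ 4 * (Polynomial.X ^ 2 - Polynomial.C c)

/-- Critical point of rank 2 of type "center". -/
def IsCenter (a b lam : ℝ) (x : State) : Prop :=
  rank a b lam x = 2 ∧
    ∃ cH cK cG c : ℝ, c < 0 ∧ HasSquaredExponent lam (integral a b lam cH cK cG) x c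

/-- Critical point of rank 2 of type "saddle". -/
def IsSaddle (a b lam : ℝ) (x : State) : Prop :=
  rank a b lam x = 2 ∧
    ∃ cH cK cG c : ℝ, 0 < c ∧ HasSquaredExponent lam (integral a b lam cH cK cG) x c

/-- Degenerate critical point of rank 2: no linear combination of the integrals that is critical
at `x` has a nonzero characteristic exponent. -/
def IsDegenerate (a b lam : ℝ) (x : State) : Prop :=
  rank a b lam x = 2 ∧
    ¬ ∃ cH cK cG c : ℝ, c ≠ 0 ∧ HasSquaredExponent lam (integral a b lam cH cK cG) x c

/-! ### The critical subsystem `M₁` -/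

/-- `x₁ = (α₁ - β₂) + i (α₂ + β₁)`; `x₂` is its conjugate. -/
def x₁ (x : State) : ℂ := ⟨al x 0 - be x 1, al x 1 + be x 0⟩

def x₂ (x : State) : ℂ := ⟨al x 0 - be x 1, -(al x 1 + be x 0)⟩

/-- `y₁ = (α₁ + β₂) + i (α₂ - β₁)`; `y₂` is its conjugate. -/
def y₁ (x : State) : ℂ := ⟨al x 0 + be x 1, al x 1 - be x 0⟩

def y₂ (x : State) : ℂ := ⟨al x 0 + be x 1, -(al x 1 - be x 0)⟩

/-- `z₁ = α₃ + i β₃`; `z₂` is its conjugate. -/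
def z₁ (x : State) : ℂ := ⟨al x 2, be x 2⟩

def z₂ (x : State) : ℂ := ⟨al x 2, -be x 2⟩

/-- `w₁ = ω₁ + i ω₂`; `w₂` is its conjugate. -/
def w₁ (x : State) : ℂ := ⟨om x 0, om x 1⟩

def w₂ (x : State) : ℂ := ⟨om x 0, -om x 1⟩

def w₃ (x : State) : ℂ := (om x 2 : ℂ)

/-- `x₂ z₁ w₁ + x₁ z₂ w₂ + z₁ z₂ (w₃ + λ)`. -/
def num (lam : ℝ) (x : State) : ℂ :=
  x₂ x * z₁ x * w₁ x + x₁ x * z₂ x * w₂ x + z₁ x * z₂ x * (w₃ x + lam)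

/-- `w₁ w₂ (w₃ - λ)`. -/
def den (lam : ℝ) (x : State) : ℂ := w₁ x * w₂ x * (w₃ x - lam)

/-- The part of the phase space where the invariant relations of the first critical subsystem
are defined and hold. -/
def M1gen (a b lam : ℝ) : Set State :=
  {x | x ∈ phaseSpace a b ∧ den lam x ≠ 0 ∧
    y₁ x = -(1 / den lam x) *
      (w₁ x * (w₃ x - lam) * (x₂ x * w₁ x + z₂ x * (w₃ x + lam)) + num lam x) ∧
    y₂ x = -(1 / den lam x) *
      (w₂ x * (w₃ x - lam) * (x₁ x * w₂ x + z₁ x * (w₃ x + lam)) + num lam x)}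

/-- The critical subsystem `M₁`. -/
def M1 (a b lam : ℝ) : Set State := closure (M1gen a b lam)

/-- The partial integral `S₁` (its values are real). -/
def S1 (lam : ℝ) (x : State) : ℂ := num lam x / (2 * den lam x)

/-- `s` is the value of the partial integral `S₁` at `x ∈ M₁`, taken by continuity from the set
where the relations defining `M₁` make sense. -/
def IsS1Value (a b lam : ℝ) (x : State) (s : ℝ) : Prop :=
  Filter.Tendsto (S1 lam) (𝓝[M1gen a b lam] x) (𝓝 (s : ℂ))

/-! ### The surfaces `Π₁`, `Π₂`, in `ℝ³(h, k, g)`, with parameters `(s, h)`, `s ≠ 0` -/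

/-- `p² = a² + b²`. -/
def pSq (a b : ℝ) : ℝ := a ^ 2 + b ^ 2

/-- `r² = a² - b²`. -/
def rSq (a b : ℝ) : ℝ := a ^ 2 - b ^ 2

/-- Parametrization of `Π₁`. -/
def surf1 (a b lam : ℝ) (q : ℝ × ℝ) : ℝ × ℝ × ℝ :=
  (q.2,
    pSq a b + (q.2 - lam ^ 2 / 2) ^ 2 - 4 * (q.2 - lam ^ 2 / 2) * q.1 + 3 * q.1 ^ 2
      - (pSq a b ^ 2 - rSq a b ^ 2) / (4 * q.1 ^ 2),
    (q.2 - lam ^ 2 / 2 - q.1) * q.1 ^ 2 + (pSq a b ^ 2 - rSq a b ^ 2) / (4 * q.1))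

/-- Parametrization of `Π₂`. -/
def surf2 (a b lam : ℝ) (q : ℝ × ℝ) : ℝ × ℝ × ℝ :=
  (q.2,
    -2 * lam ^ 2 * (q.2 - lam ^ 2 / 2 - 2 * q.1) - lam ^ 4 + rSq a b ^ 2 / (4 * q.1 ^ 2),
    pSq a b * (q.2 + lam ^ 2 / 2) / 2 - lam ^ 2 * q.1 ^ 2 - rSq a b ^ 2 / (4 * q.1))

/-- A plane curve has an ordinary (semicubical) cusp at the parameter value `t`. -/
def HasCusp (γ : ℝ → ℝ × ℝ) (t : ℝ) : Prop :=
  deriv γ t = 0 ∧ LinearIndependent ℝ ![iteratedDeriv 2 γ t, iteratedDeriv 3 γ t]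

/-- The cuspidal edge (edge of regression) of `Π₁` in the parameter plane: the points at which the
section of `Π₁` by the plane `h = const` has an ordinary cusp, together with their limit points
(the points where the edge itself turns back). -/
def cuspidalEdge1 (a b lam : ℝ) : Set (ℝ × ℝ) :=
  closure {q | q.1 ≠ 0 ∧ HasCusp (fun t => (surf1 a b lam (t, q.2)).2) q.1}

/-- The curve of tangency of `Π₁` with `Π₂` in the parameter plane of `Π₁`: the points at which
both surfaces are regular and have the same tangent plane, together with their limit points. -/
def tangencyCurve (a b lam : ℝ) : Set (ℝ × ℝ) :=
  closure {q | q.1 ≠ 0 ∧ ∃ q' : ℝ × ℝ, q'.1 ≠ 0 ∧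
    surf2 a b lam q' = surf1 a b lam q ∧
    Function.Injective (fderiv ℝ (surf1 a b lam) q) ∧
    Function.Injective (fderiv ℝ (surf2 a b lam) q') ∧
    LinearMap.range (fderiv ℝ (surf1 a b lam) q : ℝ × ℝ →ₗ[ℝ] ℝ × ℝ × ℝ)
      = LinearMap.range (fderiv ℝ (surf2 a b lam) q' : ℝ × ℝ →ₗ[ℝ] ℝ × ℝ × ℝ)}

/-- The explicit squared characteristic exponent. -/
def muSq (a b lam s h : ℝ) : ℝ :=
  1 / (2 * s) * (12 * s ^ 4 - 8 * (h - lam ^ 2 / 2) * s ^ 3 + pSq a b ^ 2 - rSq a b ^ 2)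
    * (2 * s ^ 2 - 2 * (h + lam ^ 2 / 2) * s + pSq a b)

end KowalevskiGyrostat

end

noncomputable section

namespace KowalevskiGyrostat

/-! Fix a point x of `M1gen` and let s be the value of S₁ there. The tangent plane of Π₁ at (s, h)
is the kernel of 2 dg + s dk − 2s(h − λ²/2 − s) dh. This singles out F = 2G + sK − 2s(h − λ²/2 −
s)H, with coefficients frozen at x, as the combination that should be critical. In the coordinates
z₁/w₁, x₁/w₁ of `IsM1Chart` the relations defining M₁ become polynomial and leave one constraint.
The position of J(x) on Π₁, the criticality of F and the value of tr A_F² are then polynomial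
identities modulo this constraint and the geometric integrals (`K_relation`, `G_relation`,
`gradF_eq`, `poisson_chartGrad`, `trace_relation`).

The trace suffices for the following reason. At a critical point A_F is the Poisson operator
composed with a symmetric operator (`linearization_eq_poisson`). Involution of the integrals gives
dH∘A_F = dK∘A_F = 0, and by skew-symmetry A_F kills the fields of H and K. At rank 2 this yields a
flag of dimensions 2 ⊂ 4 ⊂ 6 on which A_F is nontrivial only in the middle quotient, so its
characteristic polynomial is μ⁴(μ² − tr A_F²/2) (`charpoly_eq_of_flag`,
`exists_charpoly_linearization`). The critical combination is unique up to a factor t, which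
multiplies the exponent by t². Hence the sign of one exponent determines the type
(`exponents_of_rank_two`, `types_of_rank_two`).

The relations, cleared of denominators in s, are closed conditions on (x, s) and bound s locally, so
S₁ has cluster points at every point of M₁. Each cluster value gives a critical combination with
coefficients s at K and 2 at G; uniqueness at rank 2 makes the cluster values coincide, and the
limit exists (`exists_S1Value`).

On either surface the section h = const satisfies g_s = −(s/2) k_s. Thus k_s controls the cusps, and
a regular tangent plane is described by s and one more number. Comparing these data gives the two
factors of μ² (`mem_cuspidalEdge1_iff`, `mem_tangencyCurve_iff`). The finitely many bad parameters
on each curve are recovered as limit points. -/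

/-! ### Gradients of the integrals and the Hamiltonian operator. -/

/-- The coordinate `ωᵢ`. -/
def coordOmega (i : Fin 3) : State →L[ℝ] ℝ :=
  (ContinuousLinearMap.proj i).comp (ContinuousLinearMap.fst ℝ _ _)

/-- The coordinate `αᵢ`. -/
def coordAlpha (i : Fin 3) : State →L[ℝ] ℝ :=
  (ContinuousLinearMap.proj i).comp
    ((ContinuousLinearMap.fst ℝ _ _).comp (ContinuousLinearMap.snd ℝ _ _))

/-- The coordinate `βᵢ`. -/
def coordBeta (i : Fin 3) : State →L[ℝ] ℝ :=
  (ContinuousLinearMap.proj i).comp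
    ((ContinuousLinearMap.snd ℝ _ _).comp (ContinuousLinearMap.snd ℝ _ _))

theorem fderiv_omega (i : Fin 3) (x v : State) :
    fderiv ℝ (fun y : State => y.1 i) x v = v.1 i := by
  change fderiv ℝ (coordOmega i) x v = _
  rw [ContinuousLinearMap.fderiv]; rfl

theorem fderiv_alpha (i : Fin 3) (x v : State) :
    fderiv ℝ (fun y : State => y.2.1 i) x v = v.2.1 i := by
  change fderiv ℝ (coordAlpha i) x v = _
  rw [ContinuousLinearMap.fderiv]; rfl

theorem fderiv_beta (i : Fin 3) (x v : State) :
    fderiv ℝ (fun y : State => y.2.2 i) x v = v.2.2 i := by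
  change fderiv ℝ (coordBeta i) x v = _
  rw [ContinuousLinearMap.fderiv]; rfl

/-- The standard bilinear pairing on `ℝ⁹`. -/
def pair (ξ v : State) : ℝ :=
  ξ.1 0 * v.1 0 + ξ.1 1 * v.1 1 + ξ.1 2 * v.1 2
    + (ξ.2.1 0 * v.2.1 0 + ξ.2.1 1 * v.2.1 1 + ξ.2.1 2 * v.2.1 2)
    + (ξ.2.2 0 * v.2.2 0 + ξ.2.2 1 * v.2.2 1 + ξ.2.2 2 * v.2.2 2)

/-- The gradient of `H` in `(ω, α, β)`. -/
def gradH (x : State) : State := (![2 * x.1 0, 2 * x.1 1, x.1 2], ![-1, 0, 0], ![0, -1, 0])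

/-- The gradient of `K` in `(ω, α, β)`. -/
def gradK (lam : ℝ) (x : State) : State :=
  (![4 * x.1 0 * (x.1 0 ^ 2 - x.1 1 ^ 2 + x.2.1 0 - x.2.2 1)
        + 4 * x.1 1 * (2 * x.1 0 * x.1 1 + x.2.1 1 + x.2.2 0)
        + 4 * lam * ((x.1 2 - lam) * x.1 0 + x.2.1 2),
      -4 * x.1 1 * (x.1 0 ^ 2 - x.1 1 ^ 2 + x.2.1 0 - x.2.2 1)
        + 4 * x.1 0 * (2 * x.1 0 * x.1 1 + x.2.1 1 + x.2.2 0)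
        + 4 * lam * ((x.1 2 - lam) * x.1 1 + x.2.2 2),
      2 * lam * (x.1 0 ^ 2 + x.1 1 ^ 2)],
    ![2 * (x.1 0 ^ 2 - x.1 1 ^ 2 + x.2.1 0 - x.2.2 1),
      2 * (2 * x.1 0 * x.1 1 + x.2.1 1 + x.2.2 0), 4 * lam * x.1 0],
    ![2 * (2 * x.1 0 * x.1 1 + x.2.1 1 + x.2.2 0),
      -2 * (x.1 0 ^ 2 - x.1 1 ^ 2 + x.2.1 0 - x.2.2 1), 4 * lam * x.1 1])

/-- The gradient of `G` in `(ω, α, β)`. -/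
def gradG (a b lam : ℝ) (x : State) : State :=
  (![(2 * x.1 0 * x.2.1 0 + 2 * x.1 1 * x.2.1 1 + (x.1 2 + lam) * x.2.1 2) * x.2.1 0
        + (2 * x.1 0 * x.2.2 0 + 2 * x.1 1 * x.2.2 1 + (x.1 2 + lam) * x.2.2 2) * x.2.2 0
        + (x.1 2 - lam) * (x.2.1 1 * x.2.2 2 - x.2.1 2 * x.2.2 1),
      (2 * x.1 0 * x.2.1 0 + 2 * x.1 1 * x.2.1 1 + (x.1 2 + lam) * x.2.1 2) * x.2.1 1
        + (2 * x.1 0 * x.2.2 0 + 2 * x.1 1 * x.2.2 1 + (x.1 2 + lam) * x.2.2 2) * x.2.2 1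
        + (x.1 2 - lam) * (x.2.1 2 * x.2.2 0 - x.2.1 0 * x.2.2 2),
      ((2 * x.1 0 * x.2.1 0 + 2 * x.1 1 * x.2.1 1 + (x.1 2 + lam) * x.2.1 2) * x.2.1 2
        + (2 * x.1 0 * x.2.2 0 + 2 * x.1 1 * x.2.2 1 + (x.1 2 + lam) * x.2.2 2) * x.2.2 2) / 2
        + x.1 0 * (x.2.1 1 * x.2.2 2 - x.2.1 2 * x.2.2 1)
        + x.1 1 * (x.2.1 2 * x.2.2 0 - x.2.1 0 * x.2.2 2)
        + x.1 2 * (x.2.1 0 * x.2.2 1 - x.2.1 1 * x.2.2 0)],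
    ![(2 * x.1 0 * x.2.1 0 + 2 * x.1 1 * x.2.1 1 + (x.1 2 + lam) * x.2.1 2) * x.1 0
        + (x.1 2 - lam) * (x.2.2 1 * (x.1 2 + lam) - x.2.2 2 * (2 * x.1 1)) / 2 - b ^ 2,
      (2 * x.1 0 * x.2.1 0 + 2 * x.1 1 * x.2.1 1 + (x.1 2 + lam) * x.2.1 2) * x.1 1
        + (x.1 2 - lam) * (x.2.2 2 * (2 * x.1 0) - x.2.2 0 * (x.1 2 + lam)) / 2,
      (2 * x.1 0 * x.2.1 0 + 2 * x.1 1 * x.2.1 1 + (x.1 2 + lam) * x.2.1 2) * (x.1 2 + lam) / 2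
        + (x.1 2 - lam) * (x.2.2 0 * x.1 1 - x.2.2 1 * x.1 0)],
    ![(2 * x.1 0 * x.2.2 0 + 2 * x.1 1 * x.2.2 1 + (x.1 2 + lam) * x.2.2 2) * x.1 0
        + (x.1 2 - lam) * (2 * x.1 1 * x.2.1 2 - (x.1 2 + lam) * x.2.1 1) / 2,
      (2 * x.1 0 * x.2.2 0 + 2 * x.1 1 * x.2.2 1 + (x.1 2 + lam) * x.2.2 2) * x.1 1
        + (x.1 2 - lam) * ((x.1 2 + lam) * x.2.1 0 - 2 * x.1 0 * x.2.1 2) / 2 - a ^ 2,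
      (2 * x.1 0 * x.2.2 0 + 2 * x.1 1 * x.2.2 1 + (x.1 2 + lam) * x.2.2 2) * (x.1 2 + lam) / 2
        + (x.1 2 - lam) * (x.1 0 * x.2.1 1 - x.1 1 * x.2.1 0)])

theorem H_eq (x : State) :
    H x = x.1 0 ^ 2 + x.1 1 ^ 2 + x.1 2 ^ 2 / 2 - x.2.1 0 - x.2.2 1 := rfl

theorem K_eq (lam : ℝ) (x : State) :
    K lam x = (x.1 0 ^ 2 - x.1 1 ^ 2 + x.2.1 0 - x.2.2 1) ^ 2
    + (2 * x.1 0 * x.1 1 + x.2.1 1 + x.2.2 0) ^ 2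
    + 2 * lam * ((x.1 2 - lam) * (x.1 0 ^ 2 + x.1 1 ^ 2)
        + 2 * x.1 0 * x.2.1 2 + 2 * x.1 1 * x.2.2 2) := rfl

theorem G_eq (a b lam : ℝ) (x : State) :
    G a b lam x = ((2 * x.1 0 * x.2.1 0 + 2 * x.1 1 * x.2.1 1 + (x.1 2 + lam) * x.2.1 2) ^ 2
      + (2 * x.1 0 * x.2.2 0 + 2 * x.1 1 * x.2.2 1 + (x.1 2 + lam) * x.2.2 2) ^ 2) / 4
    + (x.1 2 - lam) * (2 * x.1 0 * (x.2.1 1 * x.2.2 2 - x.2.1 2 * x.2.2 1)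
        + 2 * x.1 1 * (x.2.1 2 * x.2.2 0 - x.2.1 0 * x.2.2 2)
        + (x.1 2 + lam) * (x.2.1 0 * x.2.2 1 - x.2.1 1 * x.2.2 0)) / 2
    - b ^ 2 * x.2.1 0 - a ^ 2 * x.2.2 1 := by
  simp [G, momentum, om, al, be, cross_apply, dotProduct, Fin.sum_univ_three]

theorem fderiv_H (x v : State) : fderiv ℝ H x v = pair (gradH x) v := by
  have : H = fun x : State => x.1 0 ^ 2 + x.1 1 ^ 2 + x.1 2 ^ 2 / 2 - x.2.1 0 - x.2.2 1 := rfl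
  rw [this]
  simp (disch := fun_prop) [fderiv_fun_add, fderiv_fun_sub, fderiv_fun_mul, fderiv_fun_pow,
    fderiv_omega, fderiv_alpha, fderiv_beta, div_eq_mul_inv, pair, gradH]
  ring

theorem fderiv_K (lam : ℝ) (x v : State) : fderiv ℝ (K lam) x v = pair (gradK lam x) v := by
  have : K lam = fun x => _ := funext (K_eq lam)
  rw [this]
  simp (disch := fun_prop) [fderiv_fun_add, fderiv_fun_sub, fderiv_fun_mul, fderiv_fun_pow,
    fderiv_omega, fderiv_alpha, fderiv_beta, pair, gradK]
  ring

theorem fderiv_G (a b lam : ℝ) (x v : State) :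
    fderiv ℝ (G a b lam) x v = pair (gradG a b lam x) v := by
  have : G a b lam = fun x => _ := funext (G_eq a b lam)
  rw [this]
  simp (disch := fun_prop) [fderiv_fun_add, fderiv_fun_sub, fderiv_fun_mul, fderiv_fun_pow,
    fderiv_omega, fderiv_alpha, fderiv_beta, div_eq_mul_inv, pair, gradG]
  ring

/-- The Hamiltonian operator of the Lie-Poisson bracket in the coordinates `(ω, α, β)`. -/
def poisson (lam : ℝ) (x ξ : State) : State :=
  (![(2 * x.1 1 * ξ.1 2 - (x.1 2 + lam) * (ξ.1 1 / 2) + (x.2.1 1 * ξ.2.1 2 - x.2.1 2 * ξ.2.1 1)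
        + (x.2.2 1 * ξ.2.2 2 - x.2.2 2 * ξ.2.2 1)) / 2,
      ((x.1 2 + lam) * (ξ.1 0 / 2) - 2 * x.1 0 * ξ.1 2 + (x.2.1 2 * ξ.2.1 0 - x.2.1 0 * ξ.2.1 2)
        + (x.2.2 2 * ξ.2.2 0 - x.2.2 0 * ξ.2.2 2)) / 2,
      x.1 0 * ξ.1 1 - x.1 1 * ξ.1 0 + (x.2.1 0 * ξ.2.1 1 - x.2.1 1 * ξ.2.1 0)
        + (x.2.2 0 * ξ.2.2 1 - x.2.2 1 * ξ.2.2 0)],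
    ![x.2.1 1 * ξ.1 2 - x.2.1 2 * (ξ.1 1 / 2), x.2.1 2 * (ξ.1 0 / 2) - x.2.1 0 * ξ.1 2,
      x.2.1 0 * (ξ.1 1 / 2) - x.2.1 1 * (ξ.1 0 / 2)],
    ![x.2.2 1 * ξ.1 2 - x.2.2 2 * (ξ.1 1 / 2), x.2.2 2 * (ξ.1 0 / 2) - x.2.2 0 * ξ.1 2,
      x.2.2 0 * (ξ.1 1 / 2) - x.2.2 1 * (ξ.1 0 / 2)])

theorem sgrad_eq_poisson {F : State → ℝ} {x ξ : State} (lam : ℝ)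
    (h : ∀ v, fderiv ℝ F x v = pair ξ v) : sgrad lam F x = poisson lam x ξ := by
  have hα : gradAl F x = ξ.2.1 := by
    funext i; fin_cases i <;> simp [gradAl, h, pair]
  have hβ : gradBe F x = ξ.2.2 := by
    funext i; fin_cases i <;> simp [gradBe, h, pair]
  simp only [sgrad, momentumRate, gradM, hα, hβ, h, poisson, momentum, om, al, be]
  refine Prod.ext ?_ (Prod.ext ?_ ?_) <;> funext i <;> fin_cases i <;>
    simp [cross_apply, pair] <;> ring

/-- The gradient of `cH H + cK K + cG G`. -/
def gradF (a b lam cH cK cG : ℝ) (x : State) : State :=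
  cH • gradH x + cK • gradK lam x + cG • gradG a b lam x

theorem differentiable_H : Differentiable ℝ H := by
  have : H = fun x : State => x.1 0 ^ 2 + x.1 1 ^ 2 + x.1 2 ^ 2 / 2 - x.2.1 0 - x.2.2 1 := rfl
  rw [this]; fun_prop

theorem differentiable_K (lam : ℝ) : Differentiable ℝ (K lam) := by
  have : K lam = fun x => _ := funext (K_eq lam)
  rw [this]; fun_prop

theorem differentiable_G (a b lam : ℝ) : Differentiable ℝ (G a b lam) := by
  have : G a b lam = fun x => _ := funext (G_eq a b lam)
  rw [this]; fun_prop

theorem pair_add_left (ξ η v : State) : pair (ξ + η) v = pair ξ v + pair η v := by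
  simp [pair]; ring

theorem pair_smul_left (c : ℝ) (ξ v : State) : pair (c • ξ) v = c * pair ξ v := by
  simp [pair]; ring

theorem pair_comm (ξ v : State) : pair ξ v = pair v ξ := by
  simp [pair]; ring

theorem fderiv_integral (a b lam cH cK cG : ℝ) (x v : State) :
    fderiv ℝ (integral a b lam cH cK cG) x v = pair (gradF a b lam cH cK cG x) v := by
  have hF : HasFDerivAt (integral a b lam cH cK cG) (cH • fderiv ℝ H x + cK • fderiv ℝ (K lam) x
      + cG • fderiv ℝ (G a b lam) x) x :=
    (((differentiable_H x).hasFDerivAt.const_mul cH).add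
      ((differentiable_K lam x).hasFDerivAt.const_mul cK)).add
      ((differentiable_G a b lam x).hasFDerivAt.const_mul cG)
  rw [hF.fderiv]
  simp [fderiv_H, fderiv_K, fderiv_G, gradF, pair_add_left, pair_smul_left]

theorem sgrad_integral (a b lam cH cK cG : ℝ) :
    sgrad lam (integral a b lam cH cK cG) =
      fun x => poisson lam x (gradF a b lam cH cK cG x) :=
  funext fun x => sgrad_eq_poisson lam (fderiv_integral a b lam cH cK cG x)

/-! ### Second derivatives and the linearized Hamiltonian fields. -/

/-- The derivative of `gradH`. -/
def hessH (v : State) : State := (![2 * v.1 0, 2 * v.1 1, v.1 2], 0, 0)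

/-- The derivative of `gradK`. -/
def hessK (lam : ℝ) (x v : State) : State :=
  (![4 * v.1 0 * (x.1 0 ^ 2 - x.1 1 ^ 2 + x.2.1 0 - x.2.2 1)
        + 4 * x.1 0 * (2 * x.1 0 * v.1 0 - 2 * x.1 1 * v.1 1 + v.2.1 0 - v.2.2 1)
        + 4 * v.1 1 * (2 * x.1 0 * x.1 1 + x.2.1 1 + x.2.2 0)
        + 4 * x.1 1 * (2 * v.1 0 * x.1 1 + 2 * x.1 0 * v.1 1 + v.2.1 1 + v.2.2 0)
        + 4 * lam * (v.1 2 * x.1 0 + (x.1 2 - lam) * v.1 0 + v.2.1 2),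
      -4 * v.1 1 * (x.1 0 ^ 2 - x.1 1 ^ 2 + x.2.1 0 - x.2.2 1)
        - 4 * x.1 1 * (2 * x.1 0 * v.1 0 - 2 * x.1 1 * v.1 1 + v.2.1 0 - v.2.2 1)
        + 4 * v.1 0 * (2 * x.1 0 * x.1 1 + x.2.1 1 + x.2.2 0)
        + 4 * x.1 0 * (2 * v.1 0 * x.1 1 + 2 * x.1 0 * v.1 1 + v.2.1 1 + v.2.2 0)
        + 4 * lam * (v.1 2 * x.1 1 + (x.1 2 - lam) * v.1 1 + v.2.2 2),
      4 * lam * (x.1 0 * v.1 0 + x.1 1 * v.1 1)],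
    ![2 * (2 * x.1 0 * v.1 0 - 2 * x.1 1 * v.1 1 + v.2.1 0 - v.2.2 1),
      2 * (2 * v.1 0 * x.1 1 + 2 * x.1 0 * v.1 1 + v.2.1 1 + v.2.2 0),
      4 * lam * v.1 0],
    ![2 * (2 * v.1 0 * x.1 1 + 2 * x.1 0 * v.1 1 + v.2.1 1 + v.2.2 0),
      -2 * (2 * x.1 0 * v.1 0 - 2 * x.1 1 * v.1 1 + v.2.1 0 - v.2.2 1),
      4 * lam * v.1 1])

/-- The derivative of `gradG`. -/
def hessG (lam : ℝ) (x v : State) : State :=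
  (![(2 * v.1 0 * x.2.1 0 + 2 * v.1 1 * x.2.1 1 + v.1 2 * x.2.1 2
          + (2 * x.1 0 * v.2.1 0 + 2 * x.1 1 * v.2.1 1 + (x.1 2 + lam) * v.2.1 2)) * x.2.1 0
        + (2 * x.1 0 * x.2.1 0 + 2 * x.1 1 * x.2.1 1 + (x.1 2 + lam) * x.2.1 2) * v.2.1 0
        + (2 * v.1 0 * x.2.2 0 + 2 * v.1 1 * x.2.2 1 + v.1 2 * x.2.2 2
          + (2 * x.1 0 * v.2.2 0 + 2 * x.1 1 * v.2.2 1 + (x.1 2 + lam) * v.2.2 2)) * x.2.2 0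
        + (2 * x.1 0 * x.2.2 0 + 2 * x.1 1 * x.2.2 1 + (x.1 2 + lam) * x.2.2 2) * v.2.2 0
        + v.1 2 * (x.2.1 1 * x.2.2 2 - x.2.1 2 * x.2.2 1)
        + (x.1 2 - lam) * ((v.2.1 1 * x.2.2 2 - v.2.1 2 * x.2.2 1)
          + (x.2.1 1 * v.2.2 2 - x.2.1 2 * v.2.2 1)),
      (2 * v.1 0 * x.2.1 0 + 2 * v.1 1 * x.2.1 1 + v.1 2 * x.2.1 2
          + (2 * x.1 0 * v.2.1 0 + 2 * x.1 1 * v.2.1 1 + (x.1 2 + lam) * v.2.1 2)) * x.2.1 1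
        + (2 * x.1 0 * x.2.1 0 + 2 * x.1 1 * x.2.1 1 + (x.1 2 + lam) * x.2.1 2) * v.2.1 1
        + (2 * v.1 0 * x.2.2 0 + 2 * v.1 1 * x.2.2 1 + v.1 2 * x.2.2 2
          + (2 * x.1 0 * v.2.2 0 + 2 * x.1 1 * v.2.2 1 + (x.1 2 + lam) * v.2.2 2)) * x.2.2 1
        + (2 * x.1 0 * x.2.2 0 + 2 * x.1 1 * x.2.2 1 + (x.1 2 + lam) * x.2.2 2) * v.2.2 1
        + v.1 2 * (x.2.1 2 * x.2.2 0 - x.2.1 0 * x.2.2 2)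
        + (x.1 2 - lam) * ((v.2.1 2 * x.2.2 0 - v.2.1 0 * x.2.2 2)
          + (x.2.1 2 * v.2.2 0 - x.2.1 0 * v.2.2 2)),
      ((2 * v.1 0 * x.2.1 0 + 2 * v.1 1 * x.2.1 1 + v.1 2 * x.2.1 2
          + (2 * x.1 0 * v.2.1 0 + 2 * x.1 1 * v.2.1 1 + (x.1 2 + lam) * v.2.1 2)) * x.2.1 2
        + (2 * x.1 0 * x.2.1 0 + 2 * x.1 1 * x.2.1 1 + (x.1 2 + lam) * x.2.1 2) * v.2.1 2
        + (2 * v.1 0 * x.2.2 0 + 2 * v.1 1 * x.2.2 1 + v.1 2 * x.2.2 2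
          + (2 * x.1 0 * v.2.2 0 + 2 * x.1 1 * v.2.2 1 + (x.1 2 + lam) * v.2.2 2)) * x.2.2 2
        + (2 * x.1 0 * x.2.2 0 + 2 * x.1 1 * x.2.2 1 + (x.1 2 + lam) * x.2.2 2) * v.2.2 2) / 2
        + v.1 0 * (x.2.1 1 * x.2.2 2 - x.2.1 2 * x.2.2 1)
        + x.1 0 * ((v.2.1 1 * x.2.2 2 - v.2.1 2 * x.2.2 1) + (x.2.1 1 * v.2.2 2 - x.2.1 2 * v.2.2 1))
        + v.1 1 * (x.2.1 2 * x.2.2 0 - x.2.1 0 * x.2.2 2)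
        + x.1 1 * ((v.2.1 2 * x.2.2 0 - v.2.1 0 * x.2.2 2) + (x.2.1 2 * v.2.2 0 - x.2.1 0 * v.2.2 2))
        + v.1 2 * (x.2.1 0 * x.2.2 1 - x.2.1 1 * x.2.2 0)
        + x.1 2 * ((v.2.1 0 * x.2.2 1 - v.2.1 1 * x.2.2 0) + (x.2.1 0 * v.2.2 1 - x.2.1 1 * v.2.2 0))],
    ![((2 * v.1 0 * x.2.1 0 + 2 * v.1 1 * x.2.1 1 + v.1 2 * x.2.1 2
          + (2 * x.1 0 * v.2.1 0 + 2 * x.1 1 * v.2.1 1 + (x.1 2 + lam) * v.2.1 2)) * (2 * x.1 0)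
        + (2 * x.1 0 * x.2.1 0 + 2 * x.1 1 * x.2.1 1 + (x.1 2 + lam) * x.2.1 2) * (2 * v.1 0)) / 2
        + v.1 2 * (x.2.2 1 * (x.1 2 + lam) - x.2.2 2 * (2 * x.1 1)) / 2
        + (x.1 2 - lam) * ((v.2.2 1 * (x.1 2 + lam) - v.2.2 2 * (2 * x.1 1))
          + (x.2.2 1 * v.1 2 - x.2.2 2 * (2 * v.1 1))) / 2,
      ((2 * v.1 0 * x.2.1 0 + 2 * v.1 1 * x.2.1 1 + v.1 2 * x.2.1 2
          + (2 * x.1 0 * v.2.1 0 + 2 * x.1 1 * v.2.1 1 + (x.1 2 + lam) * v.2.1 2)) * (2 * x.1 1)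
        + (2 * x.1 0 * x.2.1 0 + 2 * x.1 1 * x.2.1 1 + (x.1 2 + lam) * x.2.1 2) * (2 * v.1 1)) / 2
        + v.1 2 * (x.2.2 2 * (2 * x.1 0) - x.2.2 0 * (x.1 2 + lam)) / 2
        + (x.1 2 - lam) * ((v.2.2 2 * (2 * x.1 0) - v.2.2 0 * (x.1 2 + lam))
          + (x.2.2 2 * (2 * v.1 0) - x.2.2 0 * v.1 2)) / 2,
      ((2 * v.1 0 * x.2.1 0 + 2 * v.1 1 * x.2.1 1 + v.1 2 * x.2.1 2
          + (2 * x.1 0 * v.2.1 0 + 2 * x.1 1 * v.2.1 1 + (x.1 2 + lam) * v.2.1 2)) * (x.1 2 + lam)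
        + (2 * x.1 0 * x.2.1 0 + 2 * x.1 1 * x.2.1 1 + (x.1 2 + lam) * x.2.1 2) * v.1 2) / 2
        + v.1 2 * (x.2.2 0 * (2 * x.1 1) - x.2.2 1 * (2 * x.1 0)) / 2
        + (x.1 2 - lam) * ((v.2.2 0 * (2 * x.1 1) - v.2.2 1 * (2 * x.1 0))
          + (x.2.2 0 * (2 * v.1 1) - x.2.2 1 * (2 * v.1 0))) / 2],
    ![((2 * v.1 0 * x.2.2 0 + 2 * v.1 1 * x.2.2 1 + v.1 2 * x.2.2 2
          + (2 * x.1 0 * v.2.2 0 + 2 * x.1 1 * v.2.2 1 + (x.1 2 + lam) * v.2.2 2)) * (2 * x.1 0)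
        + (2 * x.1 0 * x.2.2 0 + 2 * x.1 1 * x.2.2 1 + (x.1 2 + lam) * x.2.2 2) * (2 * v.1 0)) / 2
        + v.1 2 * ((2 * x.1 1) * x.2.1 2 - (x.1 2 + lam) * x.2.1 1) / 2
        + (x.1 2 - lam) * (((2 * v.1 1) * x.2.1 2 - v.1 2 * x.2.1 1)
          + ((2 * x.1 1) * v.2.1 2 - (x.1 2 + lam) * v.2.1 1)) / 2,
      ((2 * v.1 0 * x.2.2 0 + 2 * v.1 1 * x.2.2 1 + v.1 2 * x.2.2 2
          + (2 * x.1 0 * v.2.2 0 + 2 * x.1 1 * v.2.2 1 + (x.1 2 + lam) * v.2.2 2)) * (2 * x.1 1)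
        + (2 * x.1 0 * x.2.2 0 + 2 * x.1 1 * x.2.2 1 + (x.1 2 + lam) * x.2.2 2) * (2 * v.1 1)) / 2
        + v.1 2 * ((x.1 2 + lam) * x.2.1 0 - (2 * x.1 0) * x.2.1 2) / 2
        + (x.1 2 - lam) * ((v.1 2 * x.2.1 0 - (2 * v.1 0) * x.2.1 2)
          + ((x.1 2 + lam) * v.2.1 0 - (2 * x.1 0) * v.2.1 2)) / 2,
      ((2 * v.1 0 * x.2.2 0 + 2 * v.1 1 * x.2.2 1 + v.1 2 * x.2.2 2
          + (2 * x.1 0 * v.2.2 0 + 2 * x.1 1 * v.2.2 1 + (x.1 2 + lam) * v.2.2 2)) * (x.1 2 + lam)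
        + (2 * x.1 0 * x.2.2 0 + 2 * x.1 1 * x.2.2 1 + (x.1 2 + lam) * x.2.2 2) * v.1 2) / 2
        + v.1 2 * ((2 * x.1 0) * x.2.1 1 - (2 * x.1 1) * x.2.1 0) / 2
        + (x.1 2 - lam) * (((2 * v.1 0) * x.2.1 1 - (2 * v.1 1) * x.2.1 0)
          + ((2 * x.1 0) * v.2.1 1 - (2 * x.1 1) * v.2.1 0)) / 2])

theorem fderiv_coord {f : State → State} {x : State} (hf : DifferentiableAt ℝ f x)
    (L : State →L[ℝ] ℝ) (v : State) : L (fderiv ℝ f x v) = fderiv ℝ (fun y => L (f y)) x v := by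
  have h : HasFDerivAt (fun y => L (f y)) (L.comp (fderiv ℝ f x)) x :=
    L.hasFDerivAt.comp x hf.hasFDerivAt
  rw [h.fderiv]; rfl

theorem fderiv_coord_omega {f : State → State} {x : State} (hf : DifferentiableAt ℝ f x)
    (v : State) (i : Fin 3) : (fderiv ℝ f x v).1 i = fderiv ℝ (fun y => (f y).1 i) x v :=
  fderiv_coord hf (coordOmega i) v

theorem fderiv_coord_alpha {f : State → State} {x : State} (hf : DifferentiableAt ℝ f x)
    (v : State) (i : Fin 3) : (fderiv ℝ f x v).2.1 i = fderiv ℝ (fun y => (f y).2.1 i) x v :=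
  fderiv_coord hf (coordAlpha i) v

theorem fderiv_coord_beta {f : State → State} {x : State} (hf : DifferentiableAt ℝ f x)
    (v : State) (i : Fin 3) : (fderiv ℝ f x v).2.2 i = fderiv ℝ (fun y => (f y).2.2 i) x v :=
  fderiv_coord hf (coordBeta i) v

theorem differentiable_of_coord {f : State → State}
    (h₁ : ∀ i, Differentiable ℝ fun y => (f y).1 i)
    (h₂ : ∀ i, Differentiable ℝ fun y => (f y).2.1 i)
    (h₃ : ∀ i, Differentiable ℝ fun y => (f y).2.2 i) : Differentiable ℝ f :=
  (differentiable_pi.2 h₁).prodMk ((differentiable_pi.2 h₂).prodMk (differentiable_pi.2 h₃))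

theorem differentiable_gradH : Differentiable ℝ gradH := by
  refine differentiable_of_coord ?_ ?_ ?_ <;> intro i <;> fin_cases i <;> simp [gradH] <;> fun_prop

theorem differentiable_gradK (lam : ℝ) : Differentiable ℝ (gradK lam) := by
  refine differentiable_of_coord ?_ ?_ ?_ <;> intro i <;> fin_cases i <;> simp [gradK] <;> fun_prop

theorem differentiable_gradG (a b lam : ℝ) : Differentiable ℝ (gradG a b lam) := by
  refine differentiable_of_coord ?_ ?_ ?_ <;> intro i <;> fin_cases i <;> simp [gradG] <;> fun_prop

theorem fderiv_gradH (x v : State) : fderiv ℝ gradH x v = hessH v := by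
  refine Prod.ext ?_ (Prod.ext ?_ ?_) <;> funext i
  · rw [fderiv_coord_omega (differentiable_gradH x)]
    fin_cases i <;> simp (disch := fun_prop) [gradH, hessH, fderiv_fun_mul, fderiv_omega]
  · rw [fderiv_coord_alpha (differentiable_gradH x)]
    fin_cases i <;> simp [gradH, hessH]
  · rw [fderiv_coord_beta (differentiable_gradH x)]
    fin_cases i <;> simp [gradH, hessH]

set_option maxHeartbeats 1000000 in
theorem fderiv_gradK (lam : ℝ) (x v : State) : fderiv ℝ (gradK lam) x v = hessK lam x v := by
  refine Prod.ext ?_ (Prod.ext ?_ ?_) <;> funext i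
  · rw [fderiv_coord_omega (differentiable_gradK lam x)]
    fin_cases i <;> simp (disch := fun_prop) [gradK, hessK, fderiv_fun_add, fderiv_fun_sub,
      fderiv_fun_mul, fderiv_fun_pow, fderiv_omega, fderiv_alpha, fderiv_beta] <;> ring
  · rw [fderiv_coord_alpha (differentiable_gradK lam x)]
    fin_cases i <;> simp (disch := fun_prop) [gradK, hessK, fderiv_fun_add, fderiv_fun_sub,
      fderiv_fun_mul, fderiv_fun_pow, fderiv_omega, fderiv_alpha, fderiv_beta] <;> ring
  · rw [fderiv_coord_beta (differentiable_gradK lam x)]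
    fin_cases i <;> simp (disch := fun_prop) [gradK, hessK, fderiv_fun_add, fderiv_fun_sub,
      fderiv_fun_mul, fderiv_fun_pow, fderiv_omega, fderiv_alpha, fderiv_beta] <;> ring

set_option maxHeartbeats 2000000 in
theorem fderiv_gradG (a b lam : ℝ) (x v : State) :
    fderiv ℝ (gradG a b lam) x v = hessG lam x v := by
  refine Prod.ext ?_ (Prod.ext ?_ ?_) <;> funext i
  · rw [fderiv_coord_omega (differentiable_gradG a b lam x)]
    fin_cases i <;> simp (disch := fun_prop) [gradG, hessG, fderiv_fun_add, fderiv_fun_sub,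
      fderiv_fun_mul, fderiv_omega, fderiv_alpha, fderiv_beta, div_eq_mul_inv] <;> ring
  · rw [fderiv_coord_alpha (differentiable_gradG a b lam x)]
    fin_cases i <;> simp (disch := fun_prop) [gradG, hessG, fderiv_fun_add, fderiv_fun_sub,
      fderiv_fun_mul, fderiv_omega, fderiv_alpha, fderiv_beta, div_eq_mul_inv] <;> ring
  · rw [fderiv_coord_beta (differentiable_gradG a b lam x)]
    fin_cases i <;> simp (disch := fun_prop) [gradG, hessG, fderiv_fun_add, fderiv_fun_sub,
      fderiv_fun_mul, fderiv_omega, fderiv_alpha, fderiv_beta, div_eq_mul_inv] <;> ring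

theorem poisson_add (lam : ℝ) (x ξ η : State) :
    poisson lam x (ξ + η) = poisson lam x ξ + poisson lam x η := by
  refine Prod.ext ?_ (Prod.ext ?_ ?_) <;> funext i <;> fin_cases i <;> simp [poisson] <;> ring

theorem poisson_smul (lam c : ℝ) (x ξ : State) :
    poisson lam x (c • ξ) = c • poisson lam x ξ := by
  refine Prod.ext ?_ (Prod.ext ?_ ?_) <;> funext i <;> fin_cases i <;> simp [poisson] <;> ring

theorem pair_poisson (lam : ℝ) (x ξ η : State) :
    pair ξ (poisson lam x η) = -pair η (poisson lam x ξ) := by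
  simp [poisson, pair]; ring

theorem eq_zero_of_pair {v : State} (h : ∀ ξ, pair ξ v = 0) : v = 0 := by
  refine Prod.ext ?_ (Prod.ext ?_ ?_) <;> funext i
  · have := h (Pi.single i 1, 0, 0)
    fin_cases i <;> simpa [pair] using this
  · have := h (0, Pi.single i 1, 0)
    fin_cases i <;> simpa [pair] using this
  · have := h (0, 0, Pi.single i 1)
    fin_cases i <;> simpa [pair] using this

theorem differentiable_poisson (lam : ℝ) {g : State → State} (hg : Differentiable ℝ g) :
    Differentiable ℝ fun y => poisson lam y (g y) := by
  refine differentiable_of_coord ?_ ?_ ?_ <;> intro i <;> fin_cases i <;> simp [poisson] <;>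
    fun_prop

/-- Leibniz rule: the operator is linear in the covector and affine in the point. Its constant term
carries all of λ, so differentiating in the point leaves the operator with λ = 0 taken at v. -/
theorem fderiv_poisson (lam : ℝ) {g : State → State} (hg : Differentiable ℝ g) (x v : State) :
    fderiv ℝ (fun y => poisson lam y (g y)) x v =
      poisson lam x (fderiv ℝ g x v) + poisson 0 v (g x) := by
  have hp := differentiable_poisson lam hg x
  refine Prod.ext ?_ (Prod.ext ?_ ?_) <;> funext i
  · rw [fderiv_coord_omega hp]
    fin_cases i <;> simp (disch := fun_prop) [poisson, fderiv_fun_add, fderiv_fun_sub,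
      fderiv_fun_mul, fderiv_omega, fderiv_alpha, fderiv_beta, div_eq_mul_inv,
      fderiv_coord_omega (hg x), fderiv_coord_alpha (hg x), fderiv_coord_beta (hg x)] <;> ring
  · rw [fderiv_coord_alpha hp]
    fin_cases i <;> simp (disch := fun_prop) [poisson, fderiv_fun_sub,
      fderiv_fun_mul, fderiv_alpha, div_eq_mul_inv, fderiv_coord_omega (hg x)] <;> ring
  · rw [fderiv_coord_beta hp]
    fin_cases i <;> simp (disch := fun_prop) [poisson, fderiv_fun_sub,
      fderiv_fun_mul, fderiv_beta, div_eq_mul_inv, fderiv_coord_omega (hg x)] <;> ring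

/-- The derivative of `gradF`. -/
def hessF (lam cH cK cG : ℝ) (x v : State) : State :=
  cH • hessH v + cK • hessK lam x v + cG • hessG lam x v

theorem differentiable_gradF (a b lam cH cK cG : ℝ) :
    Differentiable ℝ (gradF a b lam cH cK cG) :=
  ((differentiable_gradH.const_smul cH).add ((differentiable_gradK lam).const_smul cK)).add
    ((differentiable_gradG a b lam).const_smul cG)

theorem fderiv_gradF (a b lam cH cK cG : ℝ) (x v : State) :
    fderiv ℝ (gradF a b lam cH cK cG) x v = hessF lam cH cK cG x v := by
  have h : HasFDerivAt (gradF a b lam cH cK cG) (cH • fderiv ℝ gradH x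
      + cK • fderiv ℝ (gradK lam) x + cG • fderiv ℝ (gradG a b lam) x) x :=
    (((differentiable_gradH x).hasFDerivAt.const_smul cH).add
      ((differentiable_gradK lam x).hasFDerivAt.const_smul cK)).add
      ((differentiable_gradG a b lam x).hasFDerivAt.const_smul cG)
  rw [h.fderiv]
  simp [fderiv_gradH, fderiv_gradK, fderiv_gradG, hessF]

/-- The linearization at `x` of the Hamiltonian field of `cH H + cK K + cG G`. -/
def linearization (a b lam cH cK cG : ℝ) (x : State) : State →ₗ[ℝ] State :=
  fderiv ℝ (sgrad lam (integral a b lam cH cK cG)) x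

theorem linearization_apply (a b lam cH cK cG : ℝ) (x v : State) :
    linearization a b lam cH cK cG x v =
      poisson lam x (hessF lam cH cK cG x v) + poisson 0 v (gradF a b lam cH cK cG x) := by
  rw [linearization, sgrad_integral]
  exact (fderiv_poisson lam (differentiable_gradF a b lam cH cK cG) x v).trans
    (by rw [fderiv_gradF])

theorem linearization_smul (a b lam cH cK cG t : ℝ) (x v : State) :
    linearization a b lam (t * cH) (t * cK) (t * cG) x v =
      t • linearization a b lam cH cK cG x v := by
  have h₁ : hessF lam (t * cH) (t * cK) (t * cG) x v = t • hessF lam cH cK cG x v := by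
    simp only [hessF]; module
  have h₂ : gradF a b lam (t * cH) (t * cK) (t * cG) x = t • gradF a b lam cH cK cG x := by
    simp only [gradF]; module
  rw [linearization_apply, linearization_apply, h₁, h₂, poisson_smul, poisson_smul, smul_add]

/-! ### Casimir functions, the phase space and its tangent space. -/

/-- Half the gradient of `α · α`. -/
def gradAA (x : State) : State := (0, x.2.1, 0)

/-- Half the gradient of `β · β`. -/
def gradBB (x : State) : State := (0, 0, x.2.2)

/-- The gradient of `α · β`. -/
def gradAB (x : State) : State := (0, x.2.2, x.2.1)

theorem geom_eq (x : State) : geom x = (x.2.1 0 ^ 2 + x.2.1 1 ^ 2 + x.2.1 2 ^ 2,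
    x.2.2 0 ^ 2 + x.2.2 1 ^ 2 + x.2.2 2 ^ 2,
    x.2.1 0 * x.2.2 0 + x.2.1 1 * x.2.2 1 + x.2.1 2 * x.2.2 2) := by
  simp [geom, al, be, dotProduct, Fin.sum_univ_three, sq]

theorem fderiv_geom (x v : State) :
    fderiv ℝ geom x v = (2 * pair (gradAA x) v, 2 * pair (gradBB x) v, pair (gradAB x) v) := by
  have hg : geom = fun x => _ := funext geom_eq
  rw [hg, DifferentiableAt.fderiv_prodMk (by fun_prop) (by fun_prop),
    DifferentiableAt.fderiv_prodMk (by fun_prop) (by fun_prop)]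
  simp (disch := fun_prop) [fderiv_fun_add, fderiv_fun_mul, fderiv_fun_pow,
    fderiv_alpha, fderiv_beta, pair, gradAA, gradBB, gradAB]
  refine ⟨by ring, by ring, by ring⟩

theorem mem_tangent {x v : State} :
    v ∈ tangent x ↔ pair (gradAA x) v = 0 ∧ pair (gradBB x) v = 0 ∧ pair (gradAB x) v = 0 := by
  change fderiv ℝ geom x v = 0 ↔ _
  rw [fderiv_geom]
  simp [Prod.ext_iff]

theorem mem_phaseSpace {a b : ℝ} {x : State} : x ∈ phaseSpace a b ↔
    x.2.1 0 ^ 2 + x.2.1 1 ^ 2 + x.2.1 2 ^ 2 = a ^ 2 ∧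
    x.2.2 0 ^ 2 + x.2.2 1 ^ 2 + x.2.2 2 ^ 2 = b ^ 2 ∧
    x.2.1 0 * x.2.2 0 + x.2.1 1 * x.2.2 1 + x.2.1 2 * x.2.2 2 = 0 := by
  change geom x = _ ↔ _
  rw [geom_eq]; simp [Prod.ext_iff]

theorem poisson_mem_tangent (lam : ℝ) (x ξ : State) : poisson lam x ξ ∈ tangent x := by
  rw [mem_tangent]
  simp [pair, gradAA, gradBB, gradAB, poisson]
  refine ⟨by ring, by ring, by ring⟩

/-- The Casimir identity `poisson lam x (gradAA x) = 0`, differentiated in the direction v; `gradAA`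
is linear. The next two lemmas do the same for the other Casimir functions. -/
theorem poisson_zero_gradAA (lam : ℝ) (x v : State) :
    poisson 0 v (gradAA x) = -poisson lam x (gradAA v) := by
  refine Prod.ext ?_ (Prod.ext ?_ ?_) <;> funext i <;> fin_cases i <;>
    simp [poisson, gradAA] <;> ring

theorem poisson_zero_gradBB (lam : ℝ) (x v : State) :
    poisson 0 v (gradBB x) = -poisson lam x (gradBB v) := by
  refine Prod.ext ?_ (Prod.ext ?_ ?_) <;> funext i <;> fin_cases i <;>
    simp [poisson, gradBB] <;> ring

theorem poisson_zero_gradAB (lam : ℝ) (x v : State) :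
    poisson 0 v (gradAB x) = -poisson lam x (gradAB v) := by
  refine Prod.ext ?_ (Prod.ext ?_ ?_) <;> funext i <;> fin_cases i <;>
    simp [poisson, gradAB] <;> ring

theorem poisson_eq_zero_of_tangent {lam : ℝ} {x ξ : State}
    (h : ∀ v ∈ tangent x, pair ξ v = 0) : poisson lam x ξ = 0 :=
  eq_zero_of_pair fun η => by
    rw [pair_poisson, h _ (poisson_mem_tangent lam x η), neg_zero]

theorem hessF_symm (lam cH cK cG : ℝ) (x v w : State) :
    pair (hessF lam cH cK cG x v) w = pair (hessF lam cH cK cG x w) v := by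
  simp [pair, hessF, hessH, hessK, hessG]; ring

/-- The linear form `pair ξ`. -/
def pairLin (ξ : State) : State →ₗ[ℝ] ℝ where
  toFun := pair ξ
  map_add' v w := by rw [pair_comm, pair_add_left, pair_comm v, pair_comm w]
  map_smul' c v := by rw [pair_comm, pair_smul_left, pair_comm v]; rfl

/-- A covector that annihilates the tangent space is a combination of the gradients of the
geometric integrals. -/
theorem exists_multipliers {x ξ : State} (h : ∀ v ∈ tangent x, pair ξ v = 0) :
    ∃ l₁ l₂ l₃ : ℝ, ξ = l₁ • gradAA x + l₂ • gradBB x + l₃ • gradAB x := by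
  -- Lagrange multipliers: the annihilator of a kernel is the range of the transpose, so ξ factors
  -- through the differential of `geom`.
  have hφ : pairLin ξ ∈ (LinearMap.ker (fderiv ℝ geom x : State →ₗ[ℝ] ℝ × ℝ × ℝ)).dualAnnihilator :=
    (Submodule.mem_dualAnnihilator _).2 h
  rw [← LinearMap.range_dualMap_eq_dualAnnihilator_ker] at hφ
  obtain ⟨ψ, hψ⟩ := hφ
  refine ⟨2 * ψ (1, 0, 0), 2 * ψ (0, 1, 0), ψ (0, 0, 1), ?_⟩
  rw [← sub_eq_zero]
  refine eq_zero_of_pair fun v => ?_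
  have h₁ : ψ (fderiv ℝ geom x v) = pair ξ v := LinearMap.congr_fun hψ v
  have h₂ : fderiv ℝ geom x v = (2 * pair (gradAA x) v) • ((1, 0, 0) : ℝ × ℝ × ℝ)
      + (2 * pair (gradBB x) v) • ((0, 1, 0) : ℝ × ℝ × ℝ)
      + pair (gradAB x) v • ((0, 0, 1) : ℝ × ℝ × ℝ) := by
    rw [fderiv_geom]; simp
  rw [h₂, map_add, map_add, map_smul, map_smul, map_smul] at h₁
  simp only [smul_eq_mul] at h₁
  rw [pair_comm, sub_eq_add_neg, ← neg_one_smul ℝ, pair_add_left, pair_smul_left, pair_add_left,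
    pair_add_left, pair_smul_left, pair_smul_left, pair_smul_left, ← h₁]
  ring

/-- At a critical point of `F`, the linearization of its Hamiltonian field is the composition of
the Hamiltonian operator with a symmetric operator. -/
theorem linearization_eq_poisson {a b lam cH cK cG : ℝ} {x : State}
    (h : ∀ v ∈ tangent x, pair (gradF a b lam cH cK cG x) v = 0) :
    ∃ S : State → State, (∀ v w, pair (S v) w = pair (S w) v) ∧
      ∀ v, linearization a b lam cH cK cG x v = poisson lam x (S v) := by
  obtain ⟨l₁, l₂, l₃, hl⟩ := exists_multipliers h
  -- The symmetric operator is the Hessian of F minus the Casimir functions weighted by the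
  -- multipliers. The multiplier terms absorb the derivative of the Poisson operator in the point.
  refine ⟨fun v => hessF lam cH cK cG x v + (-l₁) • gradAA v + (-l₂) • gradBB v
    + (-l₃) • gradAB v, fun v w => ?_, fun v => ?_⟩
  · simp only [pair_add_left, pair_smul_left, hessF_symm lam cH cK cG x v w]
    simp [pair, gradAA, gradBB, gradAB]; ring
  · rw [linearization_apply, hl]
    simp only [poisson_add, poisson_smul, poisson_zero_gradAA lam, poisson_zero_gradBB lam,
      poisson_zero_gradAB lam]
    module

/-! ### Nondegeneracy of the Poisson operator on the phase space. -/

/-- Expand in the orthogonal frame α, β, α × β. Pairing α × p + β × q = 0 with the frame vectors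
kills the (α × β)-components of p and q and gives a² β·p = b² α·q. The conditions on (u, v) say that
it is tangent to the phase space, which cancels everything that remains. -/
theorem dot_add_dot_eq_zero_of_cross {a b A0 A1 A2 B0 B1 B2 p0 p1 p2 q0 q1 q2 u0 u1 u2 v0 v1 v2 : ℝ}
    (ha : 0 < a) (hb : 0 < b) (h₁ : A0 ^ 2 + A1 ^ 2 + A2 ^ 2 = a ^ 2)
    (h₂ : B0 ^ 2 + B1 ^ 2 + B2 ^ 2 = b ^ 2) (h₃ : A0 * B0 + A1 * B1 + A2 * B2 = 0)
    (e₀ : A1 * p2 - A2 * p1 + (B1 * q2 - B2 * q1) = 0)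
    (e₁ : A2 * p0 - A0 * p2 + (B2 * q0 - B0 * q2) = 0)
    (e₂ : A0 * p1 - A1 * p0 + (B0 * q1 - B1 * q0) = 0)
    (hu : A0 * u0 + A1 * u1 + A2 * u2 = 0) (hv : B0 * v0 + B1 * v1 + B2 * v2 = 0)
    (huv : B0 * u0 + B1 * u1 + B2 * u2 + (A0 * v0 + A1 * v1 + A2 * v2) = 0) :
    p0 * u0 + p1 * u1 + p2 * u2 + (q0 * v0 + q1 * v1 + q2 * v2) = 0 := by
  have hq : (A1 * B2 - A2 * B1) * q0 + (A2 * B0 - A0 * B2) * q1 + (A0 * B1 - A1 * B0) * q2 = 0 := by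
    linear_combination A0 * e₀ + A1 * e₁ + A2 * e₂
  have hp : (A1 * B2 - A2 * B1) * p0 + (A2 * B0 - A0 * B2) * p1 + (A0 * B1 - A1 * B0) * p2 = 0 := by
    linear_combination -(B0 * e₀ + B1 * e₁ + B2 * e₂)
  have hpq : a ^ 2 * (B0 * p0 + B1 * p1 + B2 * p2) = b ^ 2 * (A0 * q0 + A1 * q1 + A2 * q2) := by
    linear_combination (A1 * B2 - A2 * B1) * e₀ + (A2 * B0 - A0 * B2) * e₁
      + (A0 * B1 - A1 * B0) * e₂ - (B0 * p0 + B1 * p1 + B2 * p2) * h₁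
      + (A0 * q0 + A1 * q1 + A2 * q2) * h₂
      + (A0 * p0 + A1 * p1 + A2 * p2 - B0 * q0 - B1 * q1 - B2 * q2) * h₃
  have frame : ∀ c0 c1 c2 d0 d1 d2 : ℝ, a ^ 2 * b ^ 2 * (c0 * d0 + c1 * d1 + c2 * d2) =
      b ^ 2 * (A0 * c0 + A1 * c1 + A2 * c2) * (A0 * d0 + A1 * d1 + A2 * d2)
      + a ^ 2 * (B0 * c0 + B1 * c1 + B2 * c2) * (B0 * d0 + B1 * d1 + B2 * d2)
      + ((A1 * B2 - A2 * B1) * c0 + (A2 * B0 - A0 * B2) * c1 + (A0 * B1 - A1 * B0) * c2)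
        * ((A1 * B2 - A2 * B1) * d0 + (A2 * B0 - A0 * B2) * d1 + (A0 * B1 - A1 * B0) * d2) := by
    intro c0 c1 c2 d0 d1 d2
    rw [← h₁, ← h₂]
    linear_combination (-(c0 * d0 + c1 * d1 + c2 * d2) * (A0 * B0 + A1 * B1 + A2 * B2)
      + (A0 * c0 + A1 * c1 + A2 * c2) * (B0 * d0 + B1 * d1 + B2 * d2)
      + (B0 * c0 + B1 * c1 + B2 * c2) * (A0 * d0 + A1 * d1 + A2 * d2)) * (-h₃)
  have h : a ^ 2 * b ^ 2 * (p0 * u0 + p1 * u1 + p2 * u2 + (q0 * v0 + q1 * v1 + q2 * v2)) = 0 := by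
    rw [mul_add, frame p0, frame q0, hp, hq, hu, hv]
    linear_combination (B0 * u0 + B1 * u1 + B2 * u2) * hpq
      + b ^ 2 * (A0 * q0 + A1 * q1 + A2 * q2) * huv
  have : a ^ 2 * b ^ 2 ≠ 0 := by positivity
  exact (mul_eq_zero.1 h).resolve_left this

theorem eq_zero_of_cross_eq_zero {a b A0 A1 A2 B0 B1 B2 m0 m1 m2 : ℝ}
    (ha : 0 < a) (hb : 0 < b) (h₁ : A0 ^ 2 + A1 ^ 2 + A2 ^ 2 = a ^ 2)
    (h₂ : B0 ^ 2 + B1 ^ 2 + B2 ^ 2 = b ^ 2) (h₃ : A0 * B0 + A1 * B1 + A2 * B2 = 0)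
    (e₀ : A1 * m2 - A2 * m1 = 0) (e₁ : A2 * m0 - A0 * m2 = 0) (e₂ : A0 * m1 - A1 * m0 = 0)
    (f₀ : B1 * m2 - B2 * m1 = 0) (f₁ : B2 * m0 - B0 * m2 = 0) (f₂ : B0 * m1 - B1 * m0 = 0) :
    m0 = 0 ∧ m1 = 0 ∧ m2 = 0 := by
  have h : A0 * m0 + A1 * m1 + A2 * m2 = 0 := by
    have : b ^ 2 * (A0 * m0 + A1 * m1 + A2 * m2) = 0 := by
      linear_combination -((A1 * B2 - A2 * B1) * f₀ + (A2 * B0 - A0 * B2) * f₁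
        + (A0 * B1 - A1 * B0) * f₂) - (A0 * m0 + A1 * m1 + A2 * m2) * h₂
        + (B0 * m0 + B1 * m1 + B2 * m2) * h₃
    exact (mul_eq_zero.1 this).resolve_left (by positivity)
  have ha' : a ^ 2 ≠ 0 := by positivity
  refine ⟨(mul_eq_zero.1 (?_ : a ^ 2 * m0 = 0)).resolve_left ha',
    (mul_eq_zero.1 (?_ : a ^ 2 * m1 = 0)).resolve_left ha',
    (mul_eq_zero.1 (?_ : a ^ 2 * m2 = 0)).resolve_left ha'⟩
  · linear_combination A0 * h - A1 * e₂ + A2 * e₁ - m0 * h₁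
  · linear_combination A1 * h - A2 * e₀ + A0 * e₂ - m1 * h₁
  · linear_combination A2 * h - A0 * e₁ + A1 * e₀ - m2 * h₁

/-- The Hamiltonian operator is nondegenerate on the tangent space. -/
theorem pair_eq_zero_of_poisson {a b lam : ℝ} (ha : 0 < a) (hb : 0 < b) {x ξ : State}
    (hx : x ∈ phaseSpace a b) (h : poisson lam x ξ = 0) {v : State} (hv : v ∈ tangent x) :
    pair ξ v = 0 := by
  obtain ⟨h₁, h₂, h₃⟩ := mem_phaseSpace.1 hx
  obtain ⟨hu, hv, huv⟩ := mem_tangent.1 hv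
  have ho : ∀ i, (poisson lam x ξ).1 i = 0 := fun i => by rw [h]; rfl
  have hα : ∀ i, (poisson lam x ξ).2.1 i = 0 := fun i => by rw [h]; rfl
  have hβ : ∀ i, (poisson lam x ξ).2.2 i = 0 := fun i => by rw [h]; rfl
  -- The α- and β-components say that the M-gradient is parallel to two orthogonal nonzero vectors,
  -- hence zero. The ω-components then reduce to α × ξ_α + β × ξ_β = 0.
  obtain ⟨m₀, m₁, m₂⟩ := eq_zero_of_cross_eq_zero ha hb h₁ h₂ h₃
    (hα 0) (hα 1) (hα 2) (hβ 0) (hβ 1) (hβ 2)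
  have e₀ := ho 0
  have e₁ := ho 1
  have e₂ := ho 2
  simp only [poisson, Matrix.cons_val] at e₀ e₁ e₂
  simp [pair, gradAA, gradBB, gradAB] at hu hv huv
  have := dot_add_dot_eq_zero_of_cross ha hb h₁ h₂ h₃
    (p0 := ξ.2.1 0) (p1 := ξ.2.1 1) (p2 := ξ.2.1 2) (q0 := ξ.2.2 0) (q1 := ξ.2.2 1)
    (q2 := ξ.2.2 2) (by linear_combination 2 * e₀ - 2 * x.1 1 * m₂ + (x.1 2 + lam) * m₁)
    (by linear_combination 2 * e₁ + 2 * x.1 0 * m₂ - (x.1 2 + lam) * m₀)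
    (by linear_combination e₂ - 2 * x.1 0 * m₁ + 2 * x.1 1 * m₀) hu hv huv
  simp only [pair]
  linear_combination this + 2 * v.1 0 * m₀ + 2 * v.1 1 * m₁ + v.1 2 * m₂

theorem finrank_tangent {a b : ℝ} (ha : 0 < a) (hb : 0 < b) {x : State}
    (hx : x ∈ phaseSpace a b) : Module.finrank ℝ (tangent x) = 6 := by
  obtain ⟨h₁, h₂, h₃⟩ := mem_phaseSpace.1 hx
  have hs : LinearMap.range (fderiv ℝ geom x : State →ₗ[ℝ] ℝ × ℝ × ℝ) = ⊤ := by
    rw [LinearMap.range_eq_top]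
    rintro ⟨p, q, r⟩
    refine ⟨(0, (p / (2 * a ^ 2)) • x.2.1, (q / (2 * b ^ 2)) • x.2.2 + (r / a ^ 2) • x.2.1), ?_⟩
    change fderiv ℝ geom x _ = _
    rw [fderiv_geom]
    simp only [pair, gradAA, gradBB, gradAB, Prod.ext_iff]
    simp
    refine ⟨?_, ?_, ?_⟩
    · field_simp; linear_combination p * h₁
    · field_simp; linear_combination q * a ^ 2 * h₂ + 2 * b ^ 2 * r * h₃
    · field_simp; linear_combination (2 * b ^ 2 * r) * h₁ + (p * b ^ 2 + a ^ 2 * q) * h₃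
  have h := LinearMap.finrank_range_add_finrank_ker (fderiv ℝ geom x : State →ₗ[ℝ] ℝ × ℝ × ℝ)
  rw [hs, finrank_top] at h
  have h9 : Module.finrank ℝ State = 9 := by
    simp only [State, Module.finrank_prod, Module.finrank_fin_fun]
  have h3 : Module.finrank ℝ (ℝ × ℝ × ℝ) = 3 := by
    simp only [Module.finrank_prod, Module.finrank_self]
  rw [h9, h3] at h
  change Module.finrank ℝ (LinearMap.ker (fderiv ℝ geom x : State →ₗ[ℝ] ℝ × ℝ × ℝ)) = 6
  omega

/-! ### Characteristic polynomial of an operator acting along a flag. -/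

section LinearAlgebra

variable {V W : Type*} [AddCommGroup V] [Module ℝ V] [FiniteDimensional ℝ V]
  [AddCommGroup W] [Module ℝ W] [FiniteDimensional ℝ W]

theorem charpoly_comp_comm_of_le (f : V →ₗ[ℝ] W) (g : W →ₗ[ℝ] V)
    (h : Module.finrank ℝ W ≤ Module.finrank ℝ V) :
    (g ∘ₗ f).charpoly =
      Polynomial.X ^ (Module.finrank ℝ V - Module.finrank ℝ W) * (f ∘ₗ g).charpoly := by
  let bV := Module.finBasis ℝ V
  let bW := Module.finBasis ℝ W
  rw [← LinearMap.charpoly_toMatrix _ bV, ← LinearMap.charpoly_toMatrix _ bW,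
    LinearMap.toMatrix_comp bV bW bV, LinearMap.toMatrix_comp bW bV bW,
    Matrix.charpoly_mul_comm_of_le _ _ (by simpa using h)]
  simp

/-- For a traceless 2 × 2 matrix tr C² = −2 det C. -/
theorem charpoly_of_finrank_two (hV : Module.finrank ℝ V = 2) (C : V →ₗ[ℝ] V)
    (hC : LinearMap.trace ℝ V C = 0) :
    C.charpoly = Polynomial.X ^ 2 - Polynomial.C (LinearMap.trace ℝ V (C ∘ₗ C) / 2) := by
  let b := Module.finBasisOfFinrankEq ℝ V hV
  rw [← LinearMap.charpoly_toMatrix _ b, Matrix.charpoly_fin_two]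
  rw [LinearMap.trace_eq_matrix_trace ℝ b] at hC ⊢
  rw [hC, LinearMap.toMatrix_comp b b b]
  have h : (LinearMap.toMatrix b b C * LinearMap.toMatrix b b C).trace / 2
      = -(LinearMap.toMatrix b b C).det := by
    rw [Matrix.trace_fin_two] at hC
    rw [Matrix.trace_fin_two, Matrix.det_fin_two]
    simp only [Matrix.mul_apply, Fin.sum_univ_two]
    rw [eq_neg_of_add_eq_zero_left hC]; ring
  rw [h]; simp

/-- The characteristic polynomial of an operator on a six-dimensional space which annihilates a
plane, preserves two independent linear forms that annihilate the plane, and is traceless. -/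
theorem charpoly_eq_of_flag (hV : Module.finrank ℝ V = 6) (A : V →ₗ[ℝ] V)
    (φ : V →ₗ[ℝ] ℝ × ℝ) (ψ : ℝ × ℝ →ₗ[ℝ] V) (hφ : Function.Surjective φ)
    (hψ : Function.Injective ψ) (hφψ : ∀ c, φ (ψ c) = 0) (hφA : ∀ v, φ (A v) = 0)
    (hAψ : ∀ c, A (ψ c) = 0) (hA : LinearMap.trace ℝ V A = 0) :
    A.charpoly = Polynomial.X ^ 4 *
      (Polynomial.X ^ 2 - Polynomial.C (LinearMap.trace ℝ V (A ∘ₗ A) / 2)) := by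
  have h2 : Module.finrank ℝ (ℝ × ℝ) = 2 := by
    rw [Module.finrank_prod, Module.finrank_self]
  have hK : Module.finrank ℝ (LinearMap.ker φ) = 4 := by
    have := LinearMap.finrank_range_add_finrank_ker φ
    rw [LinearMap.range_eq_top.2 hφ, finrank_top, h2, hV] at this
    omega
  -- A factors through ker φ, and its restriction B to ker φ factors through ker φ / im ψ. Swapping
  -- the two factors each time removes X² from the characteristic polynomial and preserves traces,
  -- leaving an operator C on a plane.
  let A' : V →ₗ[ℝ] LinearMap.ker φ := A.codRestrict _ hφA
  let ψ' : ℝ × ℝ →ₗ[ℝ] LinearMap.ker φ := ψ.codRestrict _ hφψ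
  let ι := (LinearMap.ker φ).subtype
  have hAι : A = ι ∘ₗ A' := rfl
  let B := A' ∘ₗ ι
  let L := LinearMap.range ψ'
  have hL : Module.finrank ℝ L = 2 := by
    have hinj : Function.Injective ψ' := fun c d hcd => hψ (congrArg Subtype.val hcd)
    rw [LinearMap.finrank_range_of_inj hinj, h2]
  have hQ : Module.finrank ℝ (LinearMap.ker φ ⧸ L) = 2 := by
    have := L.finrank_quotient_add_finrank
    omega
  have hBL : L ≤ LinearMap.ker B := by
    rintro _ ⟨c, rfl⟩
    exact Subtype.ext (hAψ c)
  let B' := L.liftQ B hBL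
  have hB : B = B' ∘ₗ L.mkQ := (L.liftQ_mkQ B hBL).symm
  let C := L.mkQ ∘ₗ B'
  have htr : LinearMap.trace ℝ V A = LinearMap.trace ℝ _ C := by
    rw [hAι, LinearMap.trace_comp_comm']
    change LinearMap.trace ℝ _ B = _
    rw [hB, LinearMap.trace_comp_comm']
  have htr2 : LinearMap.trace ℝ V (A ∘ₗ A) = LinearMap.trace ℝ _ (C ∘ₗ C) := by
    rw [hAι, LinearMap.comp_assoc, LinearMap.trace_comp_comm']
    change LinearMap.trace ℝ _ (B ∘ₗ B) = _
    rw [hB, LinearMap.comp_assoc, LinearMap.trace_comp_comm']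
    rfl
  have h₁ : A.charpoly = Polynomial.X ^ 2 * B.charpoly := by
    rw [hAι, charpoly_comp_comm_of_le A' ι (by omega), hV, hK]
  have h₃ : B.charpoly = Polynomial.X ^ 2 * C.charpoly := by
    rw [hB, charpoly_comp_comm_of_le L.mkQ B' (by omega), hK, hQ]
  rw [h₁, h₃, charpoly_of_finrank_two hQ C (htr ▸ hA), htr2]
  ring

end LinearAlgebra

/-! ### Traces of operators on ℝ⁹. -/

/-- The coordinate vector of `ωᵢ`. -/
def unitOmega (i : Fin 3) : State := (Pi.single i 1, 0, 0)

/-- The coordinate vector of `αᵢ`. -/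
def unitAlpha (i : Fin 3) : State := (0, Pi.single i 1, 0)

/-- The coordinate vector of `βᵢ`. -/
def unitBeta (i : Fin 3) : State := (0, 0, Pi.single i 1)

/-- The standard basis of `ℝ⁹`. -/
def stateBasis : Module.Basis (Fin 3 ⊕ Fin 3 ⊕ Fin 3) ℝ State :=
  (Pi.basisFun ℝ (Fin 3)).prod ((Pi.basisFun ℝ (Fin 3)).prod (Pi.basisFun ℝ (Fin 3)))

theorem stateBasis_omega (i : Fin 3) : stateBasis (Sum.inl i) = unitOmega i := by
  simp [stateBasis, unitOmega, Module.Basis.prod_apply]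
  rfl

theorem stateBasis_alpha (i : Fin 3) : stateBasis (Sum.inr (Sum.inl i)) = unitAlpha i := by
  simp [stateBasis, unitAlpha, Module.Basis.prod_apply]

theorem stateBasis_beta (i : Fin 3) : stateBasis (Sum.inr (Sum.inr i)) = unitBeta i := by
  simp [stateBasis, unitBeta, Module.Basis.prod_apply]

theorem stateBasis_repr_omega (v : State) (i : Fin 3) :
    stateBasis.repr v (Sum.inl i) = v.1 i := rfl

theorem stateBasis_repr_alpha (v : State) (i : Fin 3) :
    stateBasis.repr v (Sum.inr (Sum.inl i)) = v.2.1 i := rfl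

theorem stateBasis_repr_beta (v : State) (i : Fin 3) :
    stateBasis.repr v (Sum.inr (Sum.inr i)) = v.2.2 i := rfl

theorem trace_state (L : State →ₗ[ℝ] State) :
    LinearMap.trace ℝ State L = ∑ i, (L (unitOmega i)).1 i + (∑ i, (L (unitAlpha i)).2.1 i
      + ∑ i, (L (unitBeta i)).2.2 i) := by
  rw [LinearMap.trace_eq_matrix_trace ℝ stateBasis, Matrix.trace, Fintype.sum_sum_type,
    Fintype.sum_sum_type]
  simp only [Matrix.diag, LinearMap.toMatrix_apply, stateBasis_omega, stateBasis_alpha,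
    stateBasis_beta, stateBasis_repr_omega, stateBasis_repr_alpha, stateBasis_repr_beta]

/-- Squares of diagonal entries plus twice the products of opposite entries, so that each product is
expanded once. With i + 1 taken modulo 3, the pairs (i, i + 1) exhaust the unordered pairs inside a
block. -/
theorem trace_state_comp_self (L : State →ₗ[ℝ] State) :
    LinearMap.trace ℝ State (L ∘ₗ L) =
      ∑ i, ((L (unitOmega i)).1 i ^ 2 + (L (unitAlpha i)).2.1 i ^ 2 + (L (unitBeta i)).2.2 i ^ 2)
      + 2 * ∑ i, ((L (unitOmega i)).1 (i + 1) * (L (unitOmega (i + 1))).1 i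
        + (L (unitAlpha i)).2.1 (i + 1) * (L (unitAlpha (i + 1))).2.1 i
        + (L (unitBeta i)).2.2 (i + 1) * (L (unitBeta (i + 1))).2.2 i)
      + 2 * ∑ i, ∑ j, ((L (unitAlpha j)).1 i * (L (unitOmega i)).2.1 j
          + (L (unitBeta j)).1 i * (L (unitOmega i)).2.2 j
          + (L (unitBeta j)).2.1 i * (L (unitAlpha i)).2.2 j) := by
  have h : LinearMap.toMatrix stateBasis stateBasis (L ∘ₗ L) =
    LinearMap.toMatrix stateBasis stateBasis L * LinearMap.toMatrix stateBasis stateBasis L :=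
    LinearMap.toMatrix_comp _ _ _ _ _
  rw [LinearMap.trace_eq_matrix_trace ℝ stateBasis, h, Matrix.trace, Fintype.sum_sum_type,
    Fintype.sum_sum_type]
  simp only [Matrix.diag, Matrix.mul_apply, Fintype.sum_sum_type, LinearMap.toMatrix_apply,
    stateBasis_omega, stateBasis_alpha, stateBasis_beta, stateBasis_repr_omega,
    stateBasis_repr_alpha, stateBasis_repr_beta]
  simp only [Fin.sum_univ_three, show (0 : Fin 3) + 1 = 1 from rfl,
    show (1 : Fin 3) + 1 = 2 from rfl, show (2 : Fin 3) + 1 = 0 from rfl]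
  ring

theorem trace_linearization (a b lam cH cK cG : ℝ) (x : State) :
    LinearMap.trace ℝ State (linearization a b lam cH cK cG x) = 0 := by
  rw [trace_state]
  simp only [linearization_apply, Fin.sum_univ_three]
  simp [unitOmega, unitAlpha, unitBeta, poisson, hessF, gradF, hessH, hessK, hessG, gradH, gradK,
    gradG]
  ring

/-! ### Polynomial identities on the first critical subsystem. -/

/-- Coordinates on the first critical subsystem: `ζ = zr + i zi = z₁ / w₁`, `q = qr + i qi = x₁ / w₁`,
`S = w₃ + λ`, `d = w₃ - λ`, and the value `s` of the partial integral. -/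
structure IsM1Chart (lam s : ℝ) (x : State) (zr zi qr qi S d : ℝ) : Prop where
  omega2 : x.1 2 = (S + d) / 2
  lam_eq : lam = (S - d) / 2
  alpha0 : x.2.1 0 = -(x.1 1 * qi + zr * S / 2 + s)
  alpha1 : x.2.1 1 = x.1 0 * qi + zi * S / 2
  alpha2 : x.2.1 2 = zr * x.1 0 - zi * x.1 1
  beta0 : x.2.2 0 = x.1 1 * qr - zi * S / 2
  beta1 : x.2.2 1 = -(x.1 0 * qr + zr * S / 2 + s)
  beta2 : x.2.2 2 = zr * x.1 1 + zi * x.1 0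
  rel : s * d = (qr * x.1 0 + qi * x.1 1) * zr + (qi * x.1 0 - qr * x.1 1) * zi
    + (zr ^ 2 + zi ^ 2) * S / 2

namespace IsM1Chart

variable {a b lam s : ℝ} {x : State} {zr zi qr qi S d : ℝ}

theorem H_sub (h : IsM1Chart lam s x zr zi qr qi S d) :
    H x - lam ^ 2 / 2 =
      x.1 0 ^ 2 + x.1 1 ^ 2 + S * d / 2 + (qr * x.1 0 + qi * x.1 1) + zr * S + 2 * s := by
  rw [H_eq, h.omega2, h.lam_eq, h.alpha0, h.beta1]; ring

theorem K_relation (h : IsM1Chart lam s x zr zi qr qi S d) (hx : x ∈ phaseSpace a b) :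
    s ^ 2 * (K lam x - (a ^ 2 + b ^ 2) - (H x - lam ^ 2 / 2) ^ 2 + 4 * (H x - lam ^ 2 / 2) * s
      - 3 * s ^ 2) + a ^ 2 * b ^ 2 = 0 := by
  obtain ⟨h₁, h₂, h₃⟩ := mem_phaseSpace.1 hx
  -- With a² + b² and a²b² replaced by |α|² + |β|² and the Gram determinant |α|²|β|² − (α·β)², the
  -- relation follows from the chart alone, without the geometric integrals.
  have key : s ^ 2 * (K lam x - ((x.2.1 0 ^ 2 + x.2.1 1 ^ 2 + x.2.1 2 ^ 2)
      + (x.2.2 0 ^ 2 + x.2.2 1 ^ 2 + x.2.2 2 ^ 2)) - (H x - lam ^ 2 / 2) ^ 2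
      + 4 * (H x - lam ^ 2 / 2) * s - 3 * s ^ 2)
      + ((x.2.1 0 ^ 2 + x.2.1 1 ^ 2 + x.2.1 2 ^ 2) * (x.2.2 0 ^ 2 + x.2.2 1 ^ 2 + x.2.2 2 ^ 2)
      - (x.2.1 0 * x.2.2 0 + x.2.1 1 * x.2.2 1 + x.2.1 2 * x.2.2 2) ^ 2) = 0 := by
    rw [h.H_sub, K_eq, h.omega2, h.lam_eq, h.alpha0, h.alpha1, h.alpha2, h.beta0, h.beta1, h.beta2]
    linear_combination (-(x.1 0 ^ 2 + x.1 1 ^ 2 + S ^ 2 / 4)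
      * ((qr * x.1 0 + qi * x.1 1) * zr + (qi * x.1 0 - qr * x.1 1) * zi
        + (zr ^ 2 + zi ^ 2) * S / 2 + d * s) - S * (qr * x.1 0 + qi * x.1 1) * s
      - 2 * (x.1 0 ^ 2 + x.1 1 ^ 2) * s * zr - S ^ 2 * s * zr) * h.rel
  rw [h₁, h₂, h₃] at key
  linear_combination key

theorem G_relation (h : IsM1Chart lam s x zr zi qr qi S d) (hx : x ∈ phaseSpace a b) :
    s * (G a b lam x - (H x - lam ^ 2 / 2 - s) * s ^ 2) = a ^ 2 * b ^ 2 := by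
  obtain ⟨h₁, h₂, h₃⟩ := mem_phaseSpace.1 hx
  -- G contains the constants a² and b² explicitly. The added terms trade them for |α|² and |β|² and
  -- correct by (α·β)(α₂ + β₁), after which the identity again follows from the chart alone.
  have key : s * (G a b lam x + (b ^ 2 - (x.2.2 0 ^ 2 + x.2.2 1 ^ 2 + x.2.2 2 ^ 2)) * x.2.1 0
      + (a ^ 2 - (x.2.1 0 ^ 2 + x.2.1 1 ^ 2 + x.2.1 2 ^ 2)) * x.2.2 1
      + (x.2.1 0 * x.2.2 0 + x.2.1 1 * x.2.2 1 + x.2.1 2 * x.2.2 2) * (x.2.1 1 + x.2.2 0)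
      - (H x - lam ^ 2 / 2 - s) * s ^ 2)
      - ((x.2.1 0 ^ 2 + x.2.1 1 ^ 2 + x.2.1 2 ^ 2) * (x.2.2 0 ^ 2 + x.2.2 1 ^ 2 + x.2.2 2 ^ 2)
      - (x.2.1 0 * x.2.2 0 + x.2.1 1 * x.2.2 1 + x.2.1 2 * x.2.2 2) ^ 2) = 0 := by
    rw [h.H_sub, G_eq, h.omega2, h.lam_eq, h.alpha0, h.alpha1, h.alpha2, h.beta0, h.beta1, h.beta2]
    linear_combination ((x.1 0 ^ 2 + x.1 1 ^ 2 + S ^ 2 / 4)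
      * ((qr * x.1 0 + qi * x.1 1) * zr + (qi * x.1 0 - qr * x.1 1) * zi
        + (zr ^ 2 + zi ^ 2) * S / 2) + S * (qr * x.1 0 + qi * x.1 1) * s / 2
      + (x.1 0 ^ 2 + x.1 1 ^ 2) * s * zr + S ^ 2 * s * zr / 2) * h.rel
  rw [h₁, h₂, h₃] at key
  linear_combination key

end IsM1Chart

/-- The gradient of the critical integral in the coordinates of `IsM1Chart`. -/
def chartGrad (x : State) (zr zi qr qi S d : ℝ) : State :=
  (0, ![-2 * x.2.2 2 ^ 2 - 2 * (x.1 0 ^ 2 + x.1 1 ^ 2) * qr ^ 2 - 2 * S * qr * x.2.1 2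
        - S * d * x.1 0 * qr - 2 * d * x.1 1 * x.2.2 2 - S ^ 2 * d * zr / 2
        - S ^ 2 * (zr ^ 2 + zi ^ 2) / 2,
      2 * x.2.1 2 * x.2.2 2 - 2 * (x.1 0 ^ 2 + x.1 1 ^ 2) * qr * qi
        - S * (qi * x.2.1 2 + qr * x.2.2 2) - S * d * x.1 1 * qr + 2 * d * x.1 0 * x.2.2 2
        + S ^ 2 * d * zi / 2,
      d * (S * x.2.1 2 + 2 * (x.1 0 ^ 2 + x.1 1 ^ 2) * qr)],
    ![2 * x.2.1 2 * x.2.2 2 - 2 * (x.1 0 ^ 2 + x.1 1 ^ 2) * qr * qi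
        - S * (qi * x.2.1 2 + qr * x.2.2 2) - S * d * x.1 0 * qi + 2 * d * x.1 1 * x.2.1 2
        - S ^ 2 * d * zi / 2,
      -2 * x.2.1 2 ^ 2 - 2 * (x.1 0 ^ 2 + x.1 1 ^ 2) * qi ^ 2 - 2 * S * qi * x.2.2 2
        - S * d * x.1 1 * qi - 2 * d * x.1 0 * x.2.1 2 - S ^ 2 * d * zr / 2
        - S ^ 2 * (zr ^ 2 + zi ^ 2) / 2,
      d * (S * x.2.2 2 + 2 * (x.1 0 ^ 2 + x.1 1 ^ 2) * qi)])

namespace IsM1Chart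

variable {a b lam s : ℝ} {x : State} {zr zi qr qi S d : ℝ}

/-- The combination is the covector annihilating the tangent plane of Π₁ at (s, h). Its ω-gradient
vanishes, so criticality becomes a condition on the α- and β-gradients only. -/
theorem gradF_eq (h : IsM1Chart lam s x zr zi qr qi S d) (hx : x ∈ phaseSpace a b) :
    gradF a b lam (-2 * s * (H x - lam ^ 2 / 2 - s)) s 2 x = chartGrad x zr zi qr qi S d := by
  obtain ⟨h₁, h₂, h₃⟩ := mem_phaseSpace.1 hx
  rw [h.alpha0, h.alpha1, h.alpha2] at h₁ h₃
  rw [h.beta0, h.beta1, h.beta2] at h₂ h₃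
  rw [h.H_sub]
  refine Prod.ext ?_ (Prod.ext ?_ ?_) <;> funext i <;> fin_cases i <;>
    simp [gradF, gradH, gradK, gradG, chartGrad] <;>
    simp only [h.omega2, h.lam_eq, h.alpha0, h.alpha1, h.alpha2, h.beta0, h.beta1, h.beta2]
  · linear_combination (-2 * x.1 0 * d) * h.rel
  · linear_combination (-2 * x.1 1 * d) * h.rel
  · linear_combination (-2 * (x.1 0 ^ 2 + x.1 1 ^ 2) - S * d / 2 - S ^ 2 / 2) * h.rel
  · linear_combination 2 * h₂
  · linear_combination -2 * h₃
  · ring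
  · linear_combination -2 * h₃
  · linear_combination 2 * h₁
  · ring

/-- As the ω-part of the covector is zero, only the M-components of the field remain, namely the
vector α × ξ_α + β × ξ_β. It vanishes modulo the chart constraint. -/
theorem poisson_chartGrad (h : IsM1Chart lam s x zr zi qr qi S d) :
    poisson lam x (chartGrad x zr zi qr qi S d) = 0 := by
  refine Prod.ext ?_ (Prod.ext ?_ ?_) <;> funext i <;> fin_cases i <;>
    simp [poisson, chartGrad]
  all_goals
    simp only [h.alpha0, h.alpha1, h.alpha2, h.beta0, h.beta1, h.beta2]
  · linear_combination (-S * (zr * x.1 1 + zi * x.1 0)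
      - 2 * (x.1 0 ^ 2 + x.1 1 ^ 2) * qi) * h.rel
  · linear_combination (S * (zr * x.1 0 - zi * x.1 1)
      + 2 * (x.1 0 ^ 2 + x.1 1 ^ 2) * qr) * h.rel
  · linear_combination (-S * (x.1 0 * qi - x.1 1 * qr) - 2 * (x.1 0 ^ 2 + x.1 1 ^ 2) * zi
      - S ^ 2 * zi) * h.rel

set_option maxHeartbeats 8000000 in
-- Here n = |w₁|², u + it = q w₂ and Z = |ζ|²; in these variables the chart constraint and its
-- cofactor are short. Replacing the gradient of F by `chartGrad` in advance keeps the expansion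
-- manageable.
theorem trace_relation_aux {cH o0 o1 n u t Z : ℝ} (h : IsM1Chart lam s x zr zi qr qi S d)
    (hg : gradF a b lam cH s 2 x = chartGrad x zr zi qr qi S d)
    (ho0 : x.1 0 = o0) (ho1 : x.1 1 = o1)
    (hn : n = o0 ^ 2 + o1 ^ 2) (hu : u = qr * o0 + qi * o1) (ht : t = qi * o0 - qr * o1)
    (hZ : Z = zr ^ 2 + zi ^ 2) (hc : cH = -2 * s * (n + S * d / 2 + u + zr * S + s)) :
    s * LinearMap.trace ℝ State
        (linearization a b lam cH s 2 x ∘ₗ linearization a b lam cH s 2 x) =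
      (12 * s ^ 4 - 8 * (n + S * d / 2 + u + zr * S + 2 * s) * s ^ 3
        + 4 * ((x.2.1 0 ^ 2 + x.2.1 1 ^ 2 + x.2.1 2 ^ 2)
            * (x.2.2 0 ^ 2 + x.2.2 1 ^ 2 + x.2.2 2 ^ 2)
          - (x.2.1 0 * x.2.2 0 + x.2.1 1 * x.2.2 1 + x.2.1 2 * x.2.2 2) ^ 2))
      * (2 * s ^ 2 - 2 * (n + S * d / 2 + u + zr * S + 2 * s + lam ^ 2) * s
        + (x.2.1 0 ^ 2 + x.2.1 1 ^ 2 + x.2.1 2 ^ 2)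
        + (x.2.2 0 ^ 2 + x.2.2 1 ^ 2 + x.2.2 2 ^ 2)) := by
  have hd : s * d = u * zr + t * zi + Z * S / 2 := by
    rw [h.rel, hu, ht, hZ, ho0, ho1]
  rw [trace_state_comp_self]
  simp only [linearization_apply, Fin.sum_univ_three, hg, chartGrad,
    show (0 : Fin 3) + 1 = 1 from rfl, show (1 : Fin 3) + 1 = 2 from rfl,
    show (2 : Fin 3) + 1 = 0 from rfl]
  simp [unitOmega, unitAlpha, unitBeta, poisson, hessF, hessH, hessK, hessG]
  simp only [h.omega2, h.lam_eq, h.alpha0, h.alpha1, h.alpha2, h.beta0, h.beta1, h.beta2, hc, ho0,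
    ho1]
  -- The cofactor of the constraint. Normalization waits until n, u, t, Z are expanded, because the
  -- trace itself is written in the original chart coordinates.
  linear_combination (norm := skip) (S * Z * d ^ 2 * n * s + 2 * S * Z * n * s * u + 2 * S * Z * n * s ^ 2 + 6 * S * Z * n * t ^
    2 + 2 * S * Z * n * u ^ 2 + 2 * S * Z ^ 2 * n ^ 2 + 2 * S * d * n * s ^ 2 * zr + S * d ^ 2 *
    s ^ 2 * u - 2 * S * d ^ 2 * s ^ 3 + 2 * S * n * s * t * zi * zr + 2 * S * n * s * u * zr ^ 2
    + 8 * S * n * s ^ 2 * zr ^ 2 - 8 * S * n * s ^ 3 + 8 * S * n * t * u * zi * zr - 4 * S * n *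
    t ^ 2 * zr ^ 2 + 4 * S * n * u ^ 2 * zr ^ 2 + 2 * S * s * t ^ 2 * u + 2 * S * s * u ^ 3 + 4
    * S * s ^ 2 * t ^ 2 + 8 * S * s ^ 2 * u ^ 2 + 3 * S ^ 2 * Z * n * s * zr + 5 * S ^ 2 * Z * n
    * t * zi + 5 * S ^ 2 * Z * n * u * zr - 2 * S ^ 2 * d * n * s ^ 2 + 2 * S ^ 2 * d * s ^ 2 *
    u + 6 * S ^ 2 * d * s ^ 3 + 1 / 2 * S ^ 2 * d ^ 2 * s * t * zi + 1 / 2 * S ^ 2 * d ^ 2 * s *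
    u * zr + S ^ 2 * d ^ 2 * s ^ 2 * zr - 1 / 2 * S ^ 2 * d ^ 3 * s ^ 2 + S ^ 2 * s * t * u * zi
    + 2 * S ^ 2 * s * t ^ 2 * zr + 3 * S ^ 2 * s * u ^ 2 * zr - 2 * S ^ 2 * s ^ 2 * t * zi + 6 *
    S ^ 2 * s ^ 2 * u * zr + S ^ 2 * t * u ^ 2 * zi + S ^ 2 * t ^ 2 * u * zr + S ^ 2 * t ^ 3 *
    zi + S ^ 2 * u ^ 3 * zr + 1 / 4 * S ^ 3 * Z * d ^ 2 * s + 1 / 2 * S ^ 3 * Z * s * u - S ^ 3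
    * Z * s ^ 2 + 3 / 2 * S ^ 3 * Z * t ^ 2 + 1 / 2 * S ^ 3 * Z * u ^ 2 + 3 / 2 * S ^ 3 * Z ^ 2
    * n + 2 * S ^ 3 * d * s ^ 2 * zr + S ^ 3 * s * t * zi * zr + S ^ 3 * s * u * zr ^ 2 + 4 * S
    ^ 3 * s ^ 2 * zr ^ 2 - 2 * S ^ 3 * s ^ 3 + 2 * S ^ 3 * t * u * zi * zr - S ^ 3 * t ^ 2 * zr
    ^ 2 + S ^ 3 * u ^ 2 * zr ^ 2 + 1 / 2 * S ^ 4 * Z * s * zr + S ^ 4 * Z * t * zi + S ^ 4 * Z *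
    u * zr + 1 / 4 * S ^ 5 * Z ^ 2 + 4 * Z * n ^ 2 * s * zr + 4 * Z * n ^ 2 * t * zi + 4 * Z * n
    ^ 2 * u * zr - 4 * d * n * s ^ 2 * u + 4 * d * n * s ^ 3 - 8 * d * n ^ 2 * s ^ 2 + 2 * d ^ 2
    * n * s * t * zi + 2 * d ^ 2 * n * s * u * zr + 6 * d ^ 2 * n * s ^ 2 * zr + 4 * n * s * t ^
    2 * zr + 4 * n * s * u ^ 2 * zr - 4 * n * s ^ 2 * t * zi + 4 * n * s ^ 2 * u * zr + 4 * n *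
    t * u ^ 2 * zi + 4 * n * t ^ 2 * u * zr + 4 * n * t ^ 3 * zi + 4 * n * u ^ 3 * zr) * hd
  subst hn hu ht hZ
  ring1

theorem trace_relation (h : IsM1Chart lam s x zr zi qr qi S d) (hx : x ∈ phaseSpace a b) :
    s * LinearMap.trace ℝ State
        (linearization a b lam (-2 * s * (H x - lam ^ 2 / 2 - s)) s 2 x
          ∘ₗ linearization a b lam (-2 * s * (H x - lam ^ 2 / 2 - s)) s 2 x) =
      (12 * s ^ 4 - 8 * (H x - lam ^ 2 / 2) * s ^ 3 + 4 * (a ^ 2 * b ^ 2))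
      * (2 * s ^ 2 - 2 * (H x + lam ^ 2 / 2) * s + (a ^ 2 + b ^ 2)) := by
  obtain ⟨h₁, h₂, h₃⟩ := mem_phaseSpace.1 hx
  rw [trace_relation_aux h (h.gradF_eq hx) rfl rfl rfl rfl rfl rfl (by rw [h.H_sub]; ring),
    h₁, h₂, h₃, ← h.H_sub]
  ring

end IsM1Chart

/-! ### From the complex relations of M₁ to the real chart. -/

/-- The real value of `num`. -/
def numRe (lam : ℝ) (x : State) : ℝ :=
  2 * ((x.2.1 0 - x.2.2 1) * (x.2.1 2 * x.1 0 - x.2.2 2 * x.1 1)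
      + (x.2.1 1 + x.2.2 0) * (x.2.1 2 * x.1 1 + x.2.2 2 * x.1 0))
    + (x.2.1 2 ^ 2 + x.2.2 2 ^ 2) * (x.1 2 + lam)

/-- The real value of `den`. -/
def denRe (lam : ℝ) (x : State) : ℝ := (x.1 0 ^ 2 + x.1 1 ^ 2) * (x.1 2 - lam)

theorem num_eq (lam : ℝ) (x : State) : num lam x = (numRe lam x : ℂ) := by
  apply Complex.ext <;> simp [num, x₁, x₂, z₁, z₂, w₁, w₂, w₃, om, al, be]
  · rw [numRe]; ring
  · ring

theorem den_eq (lam : ℝ) (x : State) : den lam x = (denRe lam x : ℂ) := by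
  apply Complex.ext
  · rw [Complex.ofReal_re, denRe]; simp [den, w₁, w₂, w₃, om]; ring_nf; simp
  · rw [Complex.ofReal_im]; simp [den, w₁, w₂, w₃, om]; ring_nf; simp

theorem S1_eq (lam : ℝ) (x : State) :
    S1 lam x = ((numRe lam x / (2 * denRe lam x) : ℝ) : ℂ) := by
  rw [S1, num_eq, den_eq]; push_cast; rfl

theorem exists_chart {a b lam : ℝ} {x : State} (hx : x ∈ M1gen a b lam) :
    ∃ zr zi qr qi S d,
      IsM1Chart lam (numRe lam x / (2 * denRe lam x)) x zr zi qr qi S d := by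
  -- N and D are real, so the relation for y₂ is the conjugate of that for y₁. The real and
  -- imaginary parts of the latter carry all the information.
  obtain ⟨-, hD, hy, -⟩ := hx
  rw [den_eq] at hD hy
  have hD' : denRe lam x ≠ 0 := by exact_mod_cast hD
  have hn : x.1 0 ^ 2 + x.1 1 ^ 2 ≠ 0 := left_ne_zero_of_mul hD'
  have hd : x.1 2 - lam ≠ 0 := right_ne_zero_of_mul hD'
  have hy' : (denRe lam x : ℂ) * y₁ x =
      -(w₁ x * (w₃ x - lam) * (x₂ x * w₁ x + z₂ x * (w₃ x + lam)) + num lam x) := by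
    rw [hy]; field_simp
  rw [num_eq] at hy'
  have hre := congrArg Complex.re hy'
  have him := congrArg Complex.im hy'
  simp [y₁, x₂, z₂, w₁, w₃, om, al, be] at hre him
  have hs : numRe lam x / (2 * denRe lam x) * (2 * denRe lam x) = numRe lam x :=
    div_mul_cancel₀ _ (by simpa using hD')
  set s := numRe lam x / (2 * denRe lam x) with hsdef
  have h₁ : (x.1 0 ^ 2 + x.1 1 ^ 2) * (x.2.1 0 + x.2.2 1 + 2 * s)
      = -((x.1 0 ^ 2 - x.1 1 ^ 2) * (x.2.1 0 - x.2.2 1)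
        + 2 * x.1 0 * x.1 1 * (x.2.1 1 + x.2.2 0)
        + (x.1 0 * x.2.1 2 + x.1 1 * x.2.2 2) * (x.1 2 + lam)) := by
    refine mul_left_cancel₀ hd ?_
    rw [← hs] at hre
    simp only [denRe] at hre
    linear_combination hre
  have h₂ : (x.1 0 ^ 2 + x.1 1 ^ 2) * (x.2.1 1 - x.2.2 0)
      = -(2 * x.1 0 * x.1 1 * (x.2.1 0 - x.2.2 1)
        - (x.1 0 ^ 2 - x.1 1 ^ 2) * (x.2.1 1 + x.2.2 0)
        + (x.1 1 * x.2.1 2 - x.1 0 * x.2.2 2) * (x.1 2 + lam)) := by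
    refine mul_left_cancel₀ hd ?_
    simp only [denRe] at him
    linear_combination him
  have h₃ : s * (2 * (x.1 2 - lam)) * (x.1 0 ^ 2 + x.1 1 ^ 2) = numRe lam x := by
    rw [← hs]; simp only [denRe]; ring
  -- Real and imaginary parts of z₁w₂/(w₁w₂) and x₁w₂/(w₁w₂).
  refine ⟨(x.2.1 2 * x.1 0 + x.2.2 2 * x.1 1) / (x.1 0 ^ 2 + x.1 1 ^ 2),
    (x.2.2 2 * x.1 0 - x.2.1 2 * x.1 1) / (x.1 0 ^ 2 + x.1 1 ^ 2),
    ((x.2.1 0 - x.2.2 1) * x.1 0 + (x.2.1 1 + x.2.2 0) * x.1 1) / (x.1 0 ^ 2 + x.1 1 ^ 2),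
    ((x.2.1 1 + x.2.2 0) * x.1 0 - (x.2.1 0 - x.2.2 1) * x.1 1) / (x.1 0 ^ 2 + x.1 1 ^ 2),
    x.1 2 + lam, x.1 2 - lam, ⟨by ring, by ring, ?_, ?_, ?_, ?_, ?_, ?_, ?_⟩⟩
  · field_simp; linear_combination h₁
  · field_simp; linear_combination h₂
  · field_simp; ring
  · field_simp; linear_combination -h₂
  · field_simp; linear_combination h₁
  · field_simp; ring
  · simp only [numRe] at h₃
    field_simp
    linear_combination (x.1 0 ^ 2 + x.1 1 ^ 2) * h₃

/-! ### Involution -/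

theorem pair_gradK_poisson_gradH (lam : ℝ) (x : State) :
    pair (gradK lam x) (poisson lam x (gradH x)) = 0 := by
  simp [pair, poisson, gradH, gradK]; ring

theorem pair_self_poisson (lam : ℝ) (x ξ : State) : pair ξ (poisson lam x ξ) = 0 := by
  have := pair_poisson lam x ξ ξ
  linarith

/-- G commutes with H only on the phase space, because it uses a² and b² instead of |β|²- and
|α|²-dependent coefficients. The exact defect on ℝ⁹ is recorded, since involution will be
differentiated. -/
theorem pair_gradH_poisson_gradG (a b lam : ℝ) (x : State) :
    pair (gradH x) (poisson lam x (gradG a b lam x)) =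
      (x.2.2 0 ^ 2 + x.2.2 1 ^ 2 + x.2.2 2 ^ 2 - b ^ 2)
          * pair (gradH x) (poisson lam x (unitAlpha 0))
        + (x.2.1 0 ^ 2 + x.2.1 1 ^ 2 + x.2.1 2 ^ 2 - a ^ 2)
          * pair (gradH x) (poisson lam x (unitBeta 1))
        + (x.2.1 0 * x.2.2 0 + x.2.1 1 * x.2.2 1 + x.2.1 2 * x.2.2 2)
          * -pair (gradH x) (poisson lam x (unitAlpha 1 + unitBeta 0)) := by
  simp [pair, poisson, gradH, gradG, unitAlpha, unitBeta]; ring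

theorem pair_gradK_poisson_gradG (a b lam : ℝ) (x : State) :
    pair (gradK lam x) (poisson lam x (gradG a b lam x)) =
      (x.2.2 0 ^ 2 + x.2.2 1 ^ 2 + x.2.2 2 ^ 2 - b ^ 2)
          * pair (gradK lam x) (poisson lam x (unitAlpha 0))
        + (x.2.1 0 ^ 2 + x.2.1 1 ^ 2 + x.2.1 2 ^ 2 - a ^ 2)
          * pair (gradK lam x) (poisson lam x (unitBeta 1))
        + (x.2.1 0 * x.2.2 0 + x.2.1 1 * x.2.2 1 + x.2.1 2 * x.2.2 2)
          * -pair (gradK lam x) (poisson lam x (unitAlpha 1 + unitBeta 0)) := by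
  simp [pair, poisson, gradK, gradG, unitAlpha, unitBeta]; ring

theorem differentiable_pair {f g : State → State} (hf : Differentiable ℝ f)
    (hg : Differentiable ℝ g) : Differentiable ℝ fun y => pair (f y) (g y) := by
  unfold pair; fun_prop

theorem fderiv_pair {f g : State → State} (hf : Differentiable ℝ f) (hg : Differentiable ℝ g)
    (x v : State) : fderiv ℝ (fun y => pair (f y) (g y)) x v =
      pair (fderiv ℝ f x v) (g x) + pair (f x) (fderiv ℝ g x v) := by
  simp (disch := fun_prop) [pair, fderiv_fun_add, fderiv_fun_mul, fderiv_coord_omega (hf x),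
    fderiv_coord_alpha (hf x), fderiv_coord_beta (hf x), fderiv_coord_omega (hg x),
    fderiv_coord_alpha (hg x), fderiv_coord_beta (hg x)]
  ring

/-- Applied with u a geometric integral minus its constant value: such a factor vanishes at x
together with its derivative along tangent vectors. -/
theorem fderiv_mul_eq_zero {u c : State → ℝ} {x v : State} (hu : Differentiable ℝ u)
    (hc : Differentiable ℝ c) (h₀ : u x = 0) (h₁ : fderiv ℝ u x v = 0) :
    fderiv ℝ (fun y => u y * c y) x v = 0 := by
  rw [fderiv_fun_mul (hu x) (hc x)]
  simp [h₀, h₁]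

theorem fderiv_const_mul_sum_eq_zero {f₁ f₂ f₃ : State → ℝ} {x v : State} (k : ℝ)
    (h₁ : Differentiable ℝ f₁) (h₂ : Differentiable ℝ f₂) (h₃ : Differentiable ℝ f₃)
    (e₁ : fderiv ℝ f₁ x v = 0) (e₂ : fderiv ℝ f₂ x v = 0) (e₃ : fderiv ℝ f₃ x v = 0) :
    fderiv ℝ (fun y => k * (f₁ y + f₂ y + f₃ y)) x v = 0 := by
  have h : HasFDerivAt (fun y => k * (f₁ y + f₂ y + f₃ y))
      (k • (fderiv ℝ f₁ x + fderiv ℝ f₂ x + fderiv ℝ f₃ x)) x :=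
    (((h₁ x).hasFDerivAt.add (h₂ x).hasFDerivAt).add (h₃ x).hasFDerivAt).const_mul k
  rw [h.fderiv]
  simp [e₁, e₂, e₃]

/-- If `g` is the gradient of an integral of the Hamiltonian field of `F` and the field vanishes at
`x`, then the linearization of the field preserves the level sets of the integral. -/
theorem pair_linearization_eq_zero {a b lam cH cK cG : ℝ} {x : State} (hx : x ∈ phaseSpace a b)
    (hcrit : poisson lam x (gradF a b lam cH cK cG x) = 0) {g : State → State}
    (hg : Differentiable ℝ g) (hH : ∀ y, pair (g y) (poisson lam y (gradH y)) = 0)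
    (hK : ∀ y, pair (g y) (poisson lam y (gradK lam y)) = 0)
    (hG : ∀ y : State, pair (g y) (poisson lam y (gradG a b lam y)) =
      (y.2.2 0 ^ 2 + y.2.2 1 ^ 2 + y.2.2 2 ^ 2 - b ^ 2)
          * pair (g y) (poisson lam y (unitAlpha 0))
        + (y.2.1 0 ^ 2 + y.2.1 1 ^ 2 + y.2.1 2 ^ 2 - a ^ 2)
          * pair (g y) (poisson lam y (unitBeta 1))
        + (y.2.1 0 * y.2.2 0 + y.2.1 1 * y.2.2 1 + y.2.1 2 * y.2.2 2)
          * -pair (g y) (poisson lam y (unitAlpha 1 + unitBeta 0)))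
    {v : State} (hv : v ∈ tangent x) :
    pair (g x) (linearization a b lam cH cK cG x v) = 0 := by
  obtain ⟨h₁, h₂, h₃⟩ := mem_phaseSpace.1 hx
  obtain ⟨v₁, v₂, v₃⟩ := mem_tangent.1 hv
  have hZ := differentiable_poisson lam (differentiable_gradF a b lam cH cK cG)
  have hc : ∀ e : State, Differentiable ℝ fun y => pair (g y) (poisson lam y e) := fun e =>
    differentiable_pair hg (differentiable_poisson lam (differentiable_const e))
  have hF : (fun y => pair (g y) (poisson lam y (gradF a b lam cH cK cG y))) = fun y =>
      cG * ((y.2.2 0 ^ 2 + y.2.2 1 ^ 2 + y.2.2 2 ^ 2 - b ^ 2)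
          * pair (g y) (poisson lam y (unitAlpha 0))
        + (y.2.1 0 ^ 2 + y.2.1 1 ^ 2 + y.2.1 2 ^ 2 - a ^ 2)
          * pair (g y) (poisson lam y (unitBeta 1))
        + (y.2.1 0 * y.2.2 0 + y.2.1 1 * y.2.2 1 + y.2.1 2 * y.2.2 2)
          * -pair (g y) (poisson lam y (unitAlpha 1 + unitBeta 0))) := by
    funext y
    rw [← hG, gradF, poisson_add, poisson_add, poisson_smul, poisson_smul, poisson_smul, pair_comm,
      pair_add_left, pair_add_left, pair_smul_left, pair_smul_left, pair_smul_left, pair_comm _ (g y),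
      pair_comm _ (g y), pair_comm _ (g y), hH, hK]
    ring
  -- Differentiate the pairing of g with the field of F. The field vanishes at x, so only the
  -- pairing of g x with the linearization survives; the other side is a sum of involution defects.
  have e := fderiv_pair hg hZ x v
  have hlin : fderiv ℝ (fun y => poisson lam y (gradF a b lam cH cK cG y)) x v =
      linearization a b lam cH cK cG x v := by
    rw [linearization, sgrad_integral]; rfl
  rw [hlin, hcrit, hF] at e
  have hβ : Differentiable ℝ fun y : State => y.2.2 0 ^ 2 + y.2.2 1 ^ 2 + y.2.2 2 ^ 2 - b ^ 2 := by
    fun_prop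
  have hα : Differentiable ℝ fun y : State => y.2.1 0 ^ 2 + y.2.1 1 ^ 2 + y.2.1 2 ^ 2 - a ^ 2 := by
    fun_prop
  have hαβ : Differentiable ℝ
      fun y : State => y.2.1 0 * y.2.2 0 + y.2.1 1 * y.2.2 1 + y.2.1 2 * y.2.2 2 := by
    fun_prop
  have eβ : fderiv ℝ (fun y : State => y.2.2 0 ^ 2 + y.2.2 1 ^ 2 + y.2.2 2 ^ 2 - b ^ 2) x v
      = 0 := by
    simp [pair, gradBB] at v₂
    simp (disch := fun_prop) [fderiv_fun_add, fderiv_fun_sub, fderiv_fun_pow, fderiv_beta]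
    linear_combination 2 * v₂
  have eα : fderiv ℝ (fun y : State => y.2.1 0 ^ 2 + y.2.1 1 ^ 2 + y.2.1 2 ^ 2 - a ^ 2) x v
      = 0 := by
    simp [pair, gradAA] at v₁
    simp (disch := fun_prop) [fderiv_fun_add, fderiv_fun_sub, fderiv_fun_pow, fderiv_alpha]
    linear_combination 2 * v₁
  have eαβ : fderiv ℝ
      (fun y : State => y.2.1 0 * y.2.2 0 + y.2.1 1 * y.2.2 1 + y.2.1 2 * y.2.2 2) x v = 0 := by
    simp [pair, gradAB] at v₃
    simp (disch := fun_prop) [fderiv_fun_add, fderiv_fun_mul, fderiv_alpha, fderiv_beta]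
    linear_combination v₃
  have hz : pair (fderiv ℝ g x v) 0 = 0 := by simp [pair]
  rw [hz, zero_add] at e
  rw [← e]
  exact fderiv_const_mul_sum_eq_zero cG (hβ.mul (hc _)) (hα.mul (hc _)) (hαβ.mul (hc _).neg)
    (fderiv_mul_eq_zero hβ (hc _) (by rw [h₂, sub_self]) eβ)
    (fderiv_mul_eq_zero hα (hc _) (by rw [h₁, sub_self]) eα)
    (fderiv_mul_eq_zero hαβ (hc _).neg h₃ eαβ)

/-! ### Points of rank 2 -/

theorem fderiv_J (a b lam : ℝ) (x v : State) : fderiv ℝ (J a b lam) x v =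
    (pair (gradH x) v, pair (gradK lam x) v, pair (gradG a b lam x) v) := by
  have h : HasFDerivAt (J a b lam) ((fderiv ℝ H x).prod
      ((fderiv ℝ (K lam) x).prod (fderiv ℝ (G a b lam) x))) x :=
    (differentiable_H x).hasFDerivAt.prodMk
      ((differentiable_K lam x).hasFDerivAt.prodMk (differentiable_G a b lam x).hasFDerivAt)
  rw [h.fderiv]
  simp [fderiv_H, fderiv_K, fderiv_G]

theorem pair_gradF (a b lam cH cK cG : ℝ) (x v : State) : pair (gradF a b lam cH cK cG x) v =
    cH * pair (gradH x) v + cK * pair (gradK lam x) v + cG * pair (gradG a b lam x) v := by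
  simp [gradF, pair_add_left, pair_smul_left]

theorem exists_tangent_of_rank {a b lam cH cK : ℝ} {x : State} (hr : rank a b lam x = 2)
    (hcrit : ∀ v ∈ tangent x, pair (gradF a b lam cH cK 2 x) v = 0) (p : ℝ × ℝ) :
    ∃ v ∈ tangent x, pair (gradH x) v = p.1 ∧ pair (gradK lam x) v = p.2 := by
  let R := (tangent x).map (fderiv ℝ (J a b lam) x : State →ₗ[ℝ] ℝ × ℝ × ℝ)
  let π : ℝ × ℝ × ℝ →ₗ[ℝ] ℝ × ℝ :=
    (LinearMap.fst ℝ ℝ (ℝ × ℝ)).prod ((LinearMap.fst ℝ ℝ ℝ).comp (LinearMap.snd ℝ ℝ (ℝ × ℝ)))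
  have hR : ∀ y ∈ R, cH * y.1 + cK * y.2.1 + 2 * y.2.2 = 0 := by
    rintro _ ⟨v, hv, rfl⟩
    have := hcrit v hv
    rw [pair_gradF] at this
    change cH * (fderiv ℝ (J a b lam) x v).1 + cK * (fderiv ℝ (J a b lam) x v).2.1
      + 2 * (fderiv ℝ (J a b lam) x v).2.2 = 0
    rw [fderiv_J]; exact this
  -- The coefficient 2 at G makes dG a combination of dH and dK. The image of dJ, a plane, therefore
  -- projects isomorphically onto the (H, K)-plane.
  have hinj : Function.Injective (π.domRestrict R) := by
    rw [← LinearMap.ker_eq_bot, LinearMap.ker_eq_bot']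
    rintro ⟨y, hy⟩ h
    have h' : (y.1, y.2.1) = ((0, 0) : ℝ × ℝ) := h
    have h₁ : y.1 = 0 := congrArg Prod.fst h'
    have h₂ : y.2.1 = 0 := congrArg Prod.snd h'
    have h₃ := hR y hy
    rw [h₁, h₂] at h₃
    exact Subtype.ext (Prod.ext h₁ (Prod.ext h₂ (by simpa using h₃)))
  have hfr : Module.finrank ℝ R = 2 := hr
  have htop : LinearMap.range (π.domRestrict R) = ⊤ := by
    refine Submodule.eq_top_of_finrank_eq ?_
    rw [LinearMap.finrank_range_of_inj hinj, hfr, Module.finrank_prod, Module.finrank_self]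
  obtain ⟨⟨_, v, hv, rfl⟩, hp⟩ : p ∈ LinearMap.range (π.domRestrict R) := htop ▸ trivial
  have hp' : ((fderiv ℝ (J a b lam) x v).1, (fderiv ℝ (J a b lam) x v).2.1) = p := hp
  rw [fderiv_J] at hp'
  exact ⟨v, hv, congrArg Prod.fst hp', congrArg Prod.snd hp'⟩

/-- At a point of rank 2 the critical combination of the integrals is unique up to a factor. -/
theorem critical_unique {a b lam cH cK cH' cK' cG' : ℝ} {x : State} (hr : rank a b lam x = 2)
    (hcrit : ∀ v ∈ tangent x, pair (gradF a b lam cH cK 2 x) v = 0)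
    (hcrit' : ∀ v ∈ tangent x, pair (gradF a b lam cH' cK' cG' x) v = 0) :
    cH' = cG' / 2 * cH ∧ cK' = cG' / 2 * cK := by
  constructor
  · obtain ⟨v, hv, h₁, h₂⟩ := exists_tangent_of_rank hr hcrit (1, 0)
    have e := hcrit v hv
    have e' := hcrit' v hv
    rw [pair_gradF, h₁, h₂] at e e'
    linear_combination e' - cG' / 2 * e
  · obtain ⟨v, hv, h₁, h₂⟩ := exists_tangent_of_rank hr hcrit (0, 1)
    have e := hcrit v hv
    have e' := hcrit' v hv
    rw [pair_gradF, h₁, h₂] at e e'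
    linear_combination e' - cG' / 2 * e

theorem exists_charpoly_linearization {a b lam cH cK cG : ℝ} (ha : 0 < a) (hb : 0 < b) {x : State}
    (hx : x ∈ phaseSpace a b)
    (hcrit : ∀ v ∈ tangent x, pair (gradF a b lam cH cK cG x) v = 0)
    (hsurj : ∀ p : ℝ × ℝ, ∃ v ∈ tangent x, pair (gradH x) v = p.1 ∧ pair (gradK lam x) v = p.2) :
    ∃ A : tangent x →ₗ[ℝ] tangent x,
      (∀ v : tangent x, (A v : State) = linearization a b lam cH cK cG x v) ∧
      A.charpoly = Polynomial.X ^ 4 * (Polynomial.X ^ 2 - Polynomial.C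
        (LinearMap.trace ℝ State (linearization a b lam cH cK cG x
          ∘ₗ linearization a b lam cH cK cG x) / 2)) := by
  obtain ⟨T, hT, hlin⟩ := linearization_eq_poisson hcrit
  set L := linearization a b lam cH cK cG x with hL
  have hz : poisson lam x (gradF a b lam cH cK cG x) = 0 := poisson_eq_zero_of_tangent hcrit
  have hrange : ∀ v, L v ∈ tangent x := fun v => by
    rw [hlin]; exact poisson_mem_tangent lam x _
  have hHL : ∀ v ∈ tangent x, pair (gradH x) (L v) = 0 := fun v hv =>
    pair_linearization_eq_zero hx hz differentiable_gradH (fun y => pair_self_poisson lam y _)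
      (fun y => by rw [pair_poisson, pair_gradK_poisson_gradH, neg_zero])
      (pair_gradH_poisson_gradG a b lam) hv
  have hKL : ∀ v ∈ tangent x, pair (gradK lam x) (L v) = 0 := fun v hv =>
    pair_linearization_eq_zero hx hz (differentiable_gradK lam)
      (pair_gradK_poisson_gradH lam) (fun y => pair_self_poisson lam y _)
      (pair_gradK_poisson_gradG a b lam) hv
  -- Duality between forms killed by L and vectors killed by L: symmetry of T and skew-symmetry of
  -- the Poisson operator turn one condition into the other.
  have hLz : ∀ ξ, (∀ v ∈ tangent x, pair ξ (L v) = 0) → L (poisson lam x ξ) = 0 := by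
    intro ξ hξ
    rw [hlin]
    refine poisson_eq_zero_of_tangent fun v hv => ?_
    rw [hT, pair_poisson, ← hlin, hξ v hv, neg_zero]
  let A : tangent x →ₗ[ℝ] tangent x := L.restrict fun v _ => hrange v
  let φ : tangent x →ₗ[ℝ] ℝ × ℝ :=
    ((pairLin (gradH x)).prod (pairLin (gradK lam x))).comp (tangent x).subtype
  let ψ : ℝ × ℝ →ₗ[ℝ] tangent x :=
    { toFun := fun c => ⟨poisson lam x (c.1 • gradH x + c.2 • gradK lam x),
        poisson_mem_tangent lam x _⟩
      map_add' := fun c d => Subtype.ext (by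
        change poisson lam x ((c.1 + d.1) • gradH x + (c.2 + d.2) • gradK lam x) =
          poisson lam x (c.1 • gradH x + c.2 • gradK lam x)
          + poisson lam x (d.1 • gradH x + d.2 • gradK lam x)
        rw [← poisson_add]; congr 1; module)
      map_smul' := fun t c => Subtype.ext (by
        change poisson lam x ((t * c.1) • gradH x + (t * c.2) • gradK lam x) =
          t • poisson lam x (c.1 • gradH x + c.2 • gradK lam x)
        rw [← poisson_smul]; congr 1; module) }
  have hφ : Function.Surjective φ := fun p => by
    obtain ⟨v, hv, h₁, h₂⟩ := hsurj p
    exact ⟨⟨v, hv⟩, Prod.ext h₁ h₂⟩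
  have hψ : Function.Injective ψ := by
    rw [← LinearMap.ker_eq_bot, LinearMap.ker_eq_bot']
    intro c hc
    have hc' : poisson lam x (c.1 • gradH x + c.2 • gradK lam x) = 0 := congrArg Subtype.val hc
    -- Evaluating the combination c on a tangent vector with dH = c.1 and dK = c.2 gives c.1² + c.2²
    -- = 0.
    obtain ⟨v, hv, h₁, h₂⟩ := hsurj c
    have := pair_eq_zero_of_poisson ha hb hx hc' hv
    rw [pair_add_left, pair_smul_left, pair_smul_left, h₁, h₂] at this
    have e₁ : c.1 = 0 := by nlinarith [mul_self_nonneg c.1, mul_self_nonneg c.2]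
    have e₂ : c.2 = 0 := by nlinarith [mul_self_nonneg c.1, mul_self_nonneg c.2]
    exact Prod.ext e₁ e₂
  have hψval : ∀ c, (ψ c : State) = poisson lam x (c.1 • gradH x + c.2 • gradK lam x) :=
    fun _ => rfl
  have hφψ : ∀ c, φ (ψ c) = 0 := fun c => by
    have h₁ : pair (gradH x) (ψ c) = 0 := by
      rw [hψval, pair_poisson, pair_add_left, pair_smul_left, pair_smul_left, pair_self_poisson,
        pair_gradK_poisson_gradH]
      simp
    have h₂ : pair (gradK lam x) (ψ c) = 0 := by
      rw [hψval, pair_poisson, pair_add_left, pair_smul_left, pair_smul_left, pair_self_poisson,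
        pair_poisson, pair_gradK_poisson_gradH]
      simp
    exact Prod.ext h₁ h₂
  have hφA : ∀ v, φ (A v) = 0 := fun v => Prod.ext (hHL v v.2) (hKL v v.2)
  have hAψ : ∀ c, A (ψ c) = 0 := fun c => Subtype.ext <| by
    change L (ψ c) = 0
    rw [hψval]
    refine hLz _ fun v hv => ?_
    rw [pair_add_left, pair_smul_left, pair_smul_left, hHL v hv, hKL v hv]
    simp
  -- The linearization maps all of ℝ⁹ into the tangent space, so traces on the tangent space equal
  -- traces on ℝ⁹.
  have htr : LinearMap.trace ℝ _ A = 0 := by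
    rw [LinearMap.trace_restrict_eq_of_forall_mem _ _ hrange, hL, trace_linearization]
  have htr2 : LinearMap.trace ℝ _ (A ∘ₗ A) = LinearMap.trace ℝ State (L ∘ₗ L) :=
    LinearMap.trace_restrict_eq_of_forall_mem (tangent x) (L ∘ₗ L) (fun v => hrange (L v))
  refine ⟨A, fun v => rfl, ?_⟩
  rw [charpoly_eq_of_flag (finrank_tangent ha hb hx) A φ ψ hφ hψ hφψ hφA hAψ htr, htr2]

/-- The operator A is determined by its values, hence so is the constant in its characteristic
polynomial. -/
theorem hasSquaredExponent_iff {a b lam cH cK cG c : ℝ} (ha : 0 < a) (hb : 0 < b) {x : State}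
    (hx : x ∈ phaseSpace a b)
    (hsurj : ∀ p : ℝ × ℝ, ∃ v ∈ tangent x, pair (gradH x) v = p.1 ∧ pair (gradK lam x) v = p.2) :
    HasSquaredExponent lam (integral a b lam cH cK cG) x c ↔
      (∀ v ∈ tangent x, pair (gradF a b lam cH cK cG x) v = 0) ∧
      c = LinearMap.trace ℝ State (linearization a b lam cH cK cG x
          ∘ₗ linearization a b lam cH cK cG x) / 2 := by
  simp only [HasSquaredExponent, fderiv_integral]
  refine and_congr_right fun hcrit => ?_
  obtain ⟨A, hA, hp⟩ := exists_charpoly_linearization ha hb hx hcrit hsurj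
  constructor
  · rintro ⟨A', hA', hp'⟩
    have hAA : A' = A := LinearMap.ext fun v => Subtype.ext ((hA' v).trans (hA v).symm)
    rw [hAA, hp] at hp'
    have := mul_left_cancel₀ (pow_ne_zero 4 Polynomial.X_ne_zero) hp'
    exact (Polynomial.C_injective (sub_right_injective this)).symm
  · rintro rfl
    exact ⟨A, hA, hp⟩

theorem trace_linearization_smul (a b lam cH cK cG t : ℝ) (x : State) :
    LinearMap.trace ℝ State (linearization a b lam (t * cH) (t * cK) (t * cG) x
      ∘ₗ linearization a b lam (t * cH) (t * cK) (t * cG) x) =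
    t ^ 2 * LinearMap.trace ℝ State (linearization a b lam cH cK cG x
      ∘ₗ linearization a b lam cH cK cG x) := by
  have h : linearization a b lam (t * cH) (t * cK) (t * cG) x =
      t • linearization a b lam cH cK cG x :=
    LinearMap.ext fun v => linearization_smul a b lam cH cK cG t x v
  rw [h, LinearMap.smul_comp, LinearMap.comp_smul, map_smul, map_smul, smul_eq_mul, smul_eq_mul]
  ring

/-- The type of a point of rank 2 is determined by the squared exponent of any critical combination
with nonzero coefficient at `G`. -/
theorem exponents_of_rank_two {a b lam cH cK : ℝ} (ha : 0 < a) (hb : 0 < b) {x : State}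
    (hx : x ∈ phaseSpace a b) (hr : rank a b lam x = 2)
    (hcrit : ∀ v ∈ tangent x, pair (gradF a b lam cH cK 2 x) v = 0) {m : ℝ}
    (hm : LinearMap.trace ℝ State (linearization a b lam cH cK 2 x
      ∘ₗ linearization a b lam cH cK 2 x) = 2 * m) :
    HasSquaredExponent lam (integral a b lam cH cK 2) x m ∧
      ∀ cH' cK' cG' c, HasSquaredExponent lam (integral a b lam cH' cK' cG') x c →
        ∃ t : ℝ, c = t ^ 2 * m := by
  have hsurj := exists_tangent_of_rank hr hcrit
  refine ⟨(hasSquaredExponent_iff ha hb hx hsurj).2 ⟨hcrit, by rw [hm]; ring⟩, ?_⟩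
  intro cH' cK' cG' c hc
  obtain ⟨hcrit', rfl⟩ := (hasSquaredExponent_iff ha hb hx hsurj).1 hc
  obtain ⟨h₁, h₂⟩ := critical_unique hr hcrit hcrit'
  refine ⟨cG' / 2, ?_⟩
  have h₃ : cG' = cG' / 2 * 2 := by ring
  rw [h₁, h₂]
  conv_lhs => rw [h₃]
  rw [show cG' / 2 * 2 / 2 = cG' / 2 by ring, trace_linearization_smul, hm]
  ring

theorem types_of_rank_two {a b lam cH cK : ℝ} (ha : 0 < a) (hb : 0 < b) {x : State}
    (hx : x ∈ phaseSpace a b) (hr : rank a b lam x = 2)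
    (hcrit : ∀ v ∈ tangent x, pair (gradF a b lam cH cK 2 x) v = 0) {m : ℝ}
    (hm : LinearMap.trace ℝ State (linearization a b lam cH cK 2 x
      ∘ₗ linearization a b lam cH cK 2 x) = 2 * m) :
    (IsCenter a b lam x ↔ m < 0) ∧ (IsSaddle a b lam x ↔ 0 < m) ∧
      (IsDegenerate a b lam x ↔ m = 0) := by
  obtain ⟨h₁, h₂⟩ := exponents_of_rank_two ha hb hx hr hcrit hm
  refine ⟨⟨?_, fun h => ⟨hr, _, _, _, m, h, h₁⟩⟩, ⟨?_, fun h => ⟨hr, _, _, _, m, h, h₁⟩⟩,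
    ⟨fun h => ?_, fun h => ⟨hr, ?_⟩⟩⟩
  · rintro ⟨-, _, _, _, c, hc, h⟩
    obtain ⟨t, rfl⟩ := h₂ _ _ _ _ h
    by_contra hm'
    exact absurd hc (not_lt.2 (mul_nonneg (sq_nonneg t) (not_lt.1 hm')))
  · rintro ⟨-, _, _, _, c, hc, h⟩
    obtain ⟨t, rfl⟩ := h₂ _ _ _ _ h
    by_contra hm'
    exact absurd hc (not_lt.2 (mul_nonpos_of_nonneg_of_nonpos (sq_nonneg t) (not_lt.1 hm')))
  · by_contra hm'
    exact h.2 ⟨_, _, _, m, hm', h₁⟩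
  · rintro ⟨_, _, _, c, hc, h'⟩
    obtain ⟨t, rfl⟩ := h₂ _ _ _ _ h'
    exact hc (by rw [h, mul_zero])

/-! ### Passage to the closure -/

theorem continuous_of_coord {X : Type*} [TopologicalSpace X] {f : X → State}
    (h₁ : ∀ i, Continuous fun y => (f y).1 i) (h₂ : ∀ i, Continuous fun y => (f y).2.1 i)
    (h₃ : ∀ i, Continuous fun y => (f y).2.2 i) : Continuous f :=
  (continuous_pi h₁).prodMk ((continuous_pi h₂).prodMk (continuous_pi h₃))

theorem Continuous.poisson {X : Type*} [TopologicalSpace X] (lam : ℝ) {f g : X → State}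
    (hf : Continuous f) (hg : Continuous g) :
    Continuous fun p => KowalevskiGyrostat.poisson lam (f p) (g p) := by
  refine continuous_of_coord ?_ ?_ ?_ <;> intro i <;> fin_cases i <;>
    simp [KowalevskiGyrostat.poisson] <;> fun_prop

theorem continuous_hessK (lam : ℝ) (v : State) : Continuous fun y => hessK lam y v := by
  refine continuous_of_coord ?_ ?_ ?_ <;> intro i <;> fin_cases i <;> simp [hessK] <;> fun_prop

theorem continuous_hessG (lam : ℝ) (v : State) : Continuous fun y => hessG lam y v := by
  refine continuous_of_coord ?_ ?_ ?_ <;> intro i <;> fin_cases i <;> simp [hessG] <;> fun_prop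

theorem continuous_H : Continuous H := differentiable_H.continuous

theorem continuous_K (lam : ℝ) : Continuous (K lam) := (differentiable_K lam).continuous

theorem continuous_G (a b lam : ℝ) : Continuous (G a b lam) := (differentiable_G a b lam).continuous

/-- The coefficient at `H` of the critical combination with coefficients `s` at `K` and `2` at
`G`. -/
def critCoeff (lam s : ℝ) (x : State) : ℝ := -2 * s * (H x - lam ^ 2 / 2 - s)

theorem continuous_critCoeff (lam : ℝ) :
    Continuous fun p : State × ℝ => critCoeff lam p.2 p.1 := by
  have := continuous_H.comp (continuous_fst (X := State) (Y := ℝ))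
  simp only [Function.comp_def] at this
  unfold critCoeff; fun_prop

theorem continuous_gradF (a b lam : ℝ) : Continuous fun p : State × ℝ =>
    gradF a b lam (critCoeff lam p.2 p.1) p.2 2 p.1 :=
  (((continuous_critCoeff lam).smul (differentiable_gradH.continuous.comp continuous_fst)).add
    (continuous_snd.smul ((differentiable_gradK lam).continuous.comp continuous_fst))).add
    (((differentiable_gradG a b lam).continuous.comp continuous_fst).const_smul (2 : ℝ))

theorem continuous_linearization (a b lam : ℝ) (v : State) : Continuous fun p : State × ℝ =>
    linearization a b lam (critCoeff lam p.2 p.1) p.2 2 p.1 v := by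
  have hh : Continuous fun p : State × ℝ => hessF lam (critCoeff lam p.2 p.1) p.2 2 p.1 v :=
    (((continuous_critCoeff lam).smul continuous_const).add
      (continuous_snd.smul ((continuous_hessK lam v).comp continuous_fst))).add
      (((continuous_hessG lam v).comp continuous_fst).const_smul (2 : ℝ))
  simp only [linearization_apply]
  exact (Continuous.poisson lam continuous_fst hh).add
    (Continuous.poisson 0 continuous_const (continuous_gradF a b lam))

theorem continuous_trace (a b lam : ℝ) : Continuous fun p : State × ℝ =>
    LinearMap.trace ℝ State (linearization a b lam (critCoeff lam p.2 p.1) p.2 2 p.1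
      ∘ₗ linearization a b lam (critCoeff lam p.2 p.1) p.2 2 p.1) := by
  have h := continuous_linearization a b lam
  have h₁ : ∀ v i, Continuous fun p : State × ℝ =>
      (linearization a b lam (critCoeff lam p.2 p.1) p.2 2 p.1 v).1 i :=
    fun v i => (continuous_apply i).comp (continuous_fst.comp (h v))
  have h₂ : ∀ v i, Continuous fun p : State × ℝ =>
      (linearization a b lam (critCoeff lam p.2 p.1) p.2 2 p.1 v).2.1 i :=
    fun v i => (continuous_apply i).comp (continuous_fst.comp (continuous_snd.comp (h v)))
  have h₃ : ∀ v i, Continuous fun p : State × ℝ =>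
      (linearization a b lam (critCoeff lam p.2 p.1) p.2 2 p.1 v).2.2 i :=
    fun v i => (continuous_apply i).comp (continuous_snd.comp (continuous_snd.comp (h v)))
  simp only [trace_state_comp_self]
  fun_prop

/-- The relations between a point of the first critical subsystem and the value of the partial
integral. -/
structure IsM1Pair (a b lam : ℝ) (p : State × ℝ) : Prop where
  mem : geom p.1 = (a ^ 2, b ^ 2, 0)
  K_rel : p.2 ^ 2 * (K lam p.1 - (a ^ 2 + b ^ 2) - (H p.1 - lam ^ 2 / 2) ^ 2
    + 4 * (H p.1 - lam ^ 2 / 2) * p.2 - 3 * p.2 ^ 2) + a ^ 2 * b ^ 2 = 0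
  G_rel : p.2 * (G a b lam p.1 - (H p.1 - lam ^ 2 / 2 - p.2) * p.2 ^ 2) = a ^ 2 * b ^ 2
  critical : poisson lam p.1 (gradF a b lam (critCoeff lam p.2 p.1) p.2 2 p.1) = 0
  trace_rel : p.2 * LinearMap.trace ℝ State
        (linearization a b lam (critCoeff lam p.2 p.1) p.2 2 p.1
          ∘ₗ linearization a b lam (critCoeff lam p.2 p.1) p.2 2 p.1) =
      (12 * p.2 ^ 4 - 8 * (H p.1 - lam ^ 2 / 2) * p.2 ^ 3 + 4 * (a ^ 2 * b ^ 2))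
      * (2 * p.2 ^ 2 - 2 * (H p.1 + lam ^ 2 / 2) * p.2 + (a ^ 2 + b ^ 2))

/-- All relations are equalities of continuous functions of (x, s). They are kept free of division
by s because s ≠ 0 is known only after passing to the limit. -/
theorem isClosed_isM1Pair (a b lam : ℝ) : IsClosed {p | IsM1Pair a b lam p} := by
  have hH := continuous_H.comp (continuous_fst (X := State) (Y := ℝ))
  have hK := (continuous_K lam).comp (continuous_fst (X := State) (Y := ℝ))
  have hG := (continuous_G a b lam).comp (continuous_fst (X := State) (Y := ℝ))
  have ht := continuous_trace a b lam
  simp only [Function.comp_def] at hH hK hG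
  have hgeom : Continuous geom := by
    have hg : geom = fun x => _ := funext geom_eq
    rw [hg]; fun_prop
  have c₁ : IsClosed {p : State × ℝ | geom p.1 = (a ^ 2, b ^ 2, 0)} :=
    isClosed_eq (hgeom.comp continuous_fst) continuous_const
  have c₂ : IsClosed {p : State × ℝ | p.2 ^ 2 * (K lam p.1 - (a ^ 2 + b ^ 2)
      - (H p.1 - lam ^ 2 / 2) ^ 2 + 4 * (H p.1 - lam ^ 2 / 2) * p.2 - 3 * p.2 ^ 2)
      + a ^ 2 * b ^ 2 = 0} := isClosed_eq (by fun_prop) continuous_const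
  have c₃ : IsClosed {p : State × ℝ |
      p.2 * (G a b lam p.1 - (H p.1 - lam ^ 2 / 2 - p.2) * p.2 ^ 2) = a ^ 2 * b ^ 2} :=
    isClosed_eq (by fun_prop) continuous_const
  have c₄ : IsClosed {p : State × ℝ |
      poisson lam p.1 (gradF a b lam (critCoeff lam p.2 p.1) p.2 2 p.1) = 0} :=
    isClosed_eq (Continuous.poisson lam continuous_fst (continuous_gradF a b lam)) continuous_const
  have c₅ : IsClosed {p : State × ℝ | p.2 * LinearMap.trace ℝ State
        (linearization a b lam (critCoeff lam p.2 p.1) p.2 2 p.1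
          ∘ₗ linearization a b lam (critCoeff lam p.2 p.1) p.2 2 p.1) =
      (12 * p.2 ^ 4 - 8 * (H p.1 - lam ^ 2 / 2) * p.2 ^ 3 + 4 * (a ^ 2 * b ^ 2))
      * (2 * p.2 ^ 2 - 2 * (H p.1 + lam ^ 2 / 2) * p.2 + (a ^ 2 + b ^ 2))} :=
    isClosed_eq (by fun_prop) (by fun_prop)
  convert c₁.inter (c₂.inter (c₃.inter (c₄.inter c₅))) using 1
  ext p
  exact ⟨fun h => ⟨h.mem, h.K_rel, h.G_rel, h.critical, h.trace_rel⟩,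
    fun h => ⟨h.1, h.2.1, h.2.2.1, h.2.2.2.1, h.2.2.2.2⟩⟩

theorem isM1Pair_of_mem {a b lam : ℝ} {x : State} (hx : x ∈ M1gen a b lam) :
    IsM1Pair a b lam (x, numRe lam x / (2 * denRe lam x)) := by
  obtain ⟨zr, zi, qr, qi, S, d, h⟩ := exists_chart hx
  refine ⟨hx.1, h.K_relation hx.1, h.G_relation hx.1, ?_, h.trace_relation hx.1⟩
  have := h.gradF_eq hx.1
  simp only [critCoeff]
  rw [this, h.poisson_chartGrad]

/-- If |s| > M ≥ 1, then 3s⁴ = As² + Bs³ + c ≤ 3M|s|³ < 3s⁴. -/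
theorem abs_le_of_quartic {s A B c M : ℝ} (hM : 1 ≤ M) (hA : |A| ≤ M) (hB : |B| ≤ M) (hc : |c| ≤ M)
    (h : s ^ 2 * (A + B * s - 3 * s ^ 2) + c = 0) : |s| ≤ M := by
  by_contra hs
  push Not at hs
  have h1 : 1 ≤ |s| := hM.trans hs.le
  have e₁ : A * s ^ 2 ≤ M * |s| ^ 2 := by
    rw [sq_abs]; exact mul_le_mul_of_nonneg_right ((le_abs_self A).trans hA) (sq_nonneg s)
  have e₂ : B * s ^ 3 ≤ M * |s| ^ 3 := by
    refine (le_abs_self _).trans ?_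
    rw [abs_mul, abs_pow]
    exact mul_le_mul_of_nonneg_right hB (by positivity)
  have e₃ : |s| ^ 2 ≤ |s| ^ 3 := pow_le_pow_right₀ h1 (by norm_num)
  have e₄ : 1 ≤ |s| ^ 3 := one_le_pow₀ h1
  have e₅ : c ≤ M := (le_abs_self c).trans hc
  have e₆ : s ^ 4 = |s| ^ 3 * |s| := by
    rw [← pow_succ, Even.pow_abs (by decide)]
  have e₇ : |s| ^ 3 * M < |s| ^ 3 * |s| := mul_lt_mul_of_pos_left hs (by positivity)
  nlinarith

/-- The relation for K is a quartic in s with leading coefficient −3 and other coefficients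
continuous in the point, so its roots are locally bounded. -/
theorem exists_bound {a b lam : ℝ} (x : State) :
    ∃ M : ℝ, ∀ᶠ y in 𝓝[M1gen a b lam] x, |numRe lam y / (2 * denRe lam y)| ≤ M := by
  let A : State → ℝ := fun y => |K lam y - (a ^ 2 + b ^ 2) - (H y - lam ^ 2 / 2) ^ 2|
  let B : State → ℝ := fun y => |4 * (H y - lam ^ 2 / 2)|
  have hH := continuous_H
  have hK := continuous_K lam
  have hA : Continuous A := by fun_prop
  have hB : Continuous B := by fun_prop
  let M := max (max (A x + 1) (B x + 1)) (max 1 |a ^ 2 * b ^ 2|)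
  refine ⟨M, ?_⟩
  have eA : ∀ᶠ y in 𝓝[M1gen a b lam] x, A y < A x + 1 :=
    (hA.tendsto x).mono_left nhdsWithin_le_nhds |>.eventually (gt_mem_nhds (lt_add_one _))
  have eB : ∀ᶠ y in 𝓝[M1gen a b lam] x, B y < B x + 1 :=
    (hB.tendsto x).mono_left nhdsWithin_le_nhds |>.eventually (gt_mem_nhds (lt_add_one _))
  filter_upwards [eA, eB, self_mem_nhdsWithin] with y h₁ h₂ h₃
  refine abs_le_of_quartic ((le_max_left _ _).trans (le_max_right _ _))
    (h₁.le.trans ((le_max_left _ _).trans (le_max_left _ _)))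
    (h₂.le.trans ((le_max_right _ _).trans (le_max_left _ _)))
    ((le_max_right _ _).trans (le_max_right _ _)) ?_
  exact (isM1Pair_of_mem h₃).K_rel

theorem isM1Pair_of_mapClusterPt {a b lam : ℝ} {x : State} {s : ℝ}
    (h : MapClusterPt s (𝓝[M1gen a b lam] x) fun y => numRe lam y / (2 * denRe lam y)) :
    IsM1Pair a b lam (x, s) := by
  obtain ⟨U, hU, hs⟩ := mapClusterPt_iff_ultrafilter.1 h
  have hx : Filter.Tendsto (fun y : State => y) U (𝓝 x) := hU.trans nhdsWithin_le_nhds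
  refine (isClosed_isM1Pair a b lam).mem_of_tendsto (hx.prodMk_nhds hs) ?_
  exact hU (Filter.mem_of_superset self_mem_nhdsWithin fun y hy => isM1Pair_of_mem hy)

theorem IsM1Pair.tangent_critical {a b lam : ℝ} (ha : 0 < a) (hb : 0 < b) {x : State} {s : ℝ}
    (h : IsM1Pair a b lam (x, s)) :
    ∀ v ∈ tangent x, pair (gradF a b lam (critCoeff lam s x) s 2 x) v = 0 :=
  fun _ hv => pair_eq_zero_of_poisson ha hb h.mem h.critical hv

/-- At a point of rank 2 of the first critical subsystem the partial integral has a limit. -/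
theorem exists_S1Value {a b lam : ℝ} (ha : 0 < a) (hb : 0 < b) {x : State}
    (hx : x ∈ M1 a b lam) (hr : rank a b lam x = 2) :
    ∃ s : ℝ, IsS1Value a b lam x s ∧ IsM1Pair a b lam (x, s) := by
  have hne : (𝓝[M1gen a b lam] x).NeBot := mem_closure_iff_nhdsWithin_neBot.1 hx
  obtain ⟨M, hM⟩ := exists_bound (a := a) (b := b) (lam := lam) x
  have hM' : ∀ᶠ y in 𝓝[M1gen a b lam] x, numRe lam y / (2 * denRe lam y) ∈ Set.Icc (-M) M := by
    filter_upwards [hM] with y hy using abs_le.1 hy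
  obtain ⟨s, -, hs⟩ := isCompact_Icc.exists_clusterPt (f := Filter.map
    (fun y => numRe lam y / (2 * denRe lam y)) (𝓝[M1gen a b lam] x))
    (Filter.le_principal_iff.2 hM')
  have hp : IsM1Pair a b lam (x, s) := isM1Pair_of_mapClusterPt hs
  refine ⟨s, ?_, hp⟩
  have hlim : Filter.Tendsto (fun y => numRe lam y / (2 * denRe lam y)) (𝓝[M1gen a b lam] x)
      (𝓝 s) := by
    refine isCompact_Icc.tendsto_nhds_of_unique_mapClusterPt hM' fun s' _ hs' => ?_
    -- Both cluster values give critical combinations with coefficient 2 at G. Uniqueness equates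
    -- their coefficients at K, which are s and s'.
    have hp' : IsM1Pair a b lam (x, s') := isM1Pair_of_mapClusterPt hs'
    have := (critical_unique hr (hp.tangent_critical ha hb) (hp'.tangent_critical ha hb)).2
    linarith
  have h := (Complex.continuous_ofReal.tendsto s).comp hlim
  refine h.congr fun y => ?_
  rw [S1_eq]; rfl

namespace IsM1Pair

variable {a b lam : ℝ} {x : State} {s : ℝ}

theorem ne_zero (ha : 0 < a) (hb : 0 < b) (h : IsM1Pair a b lam (x, s)) : s ≠ 0 := by
  rintro rfl
  have := h.G_rel
  have h' : 0 < a ^ 2 * b ^ 2 := by positivity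
  simp only [zero_mul] at this
  linarith

theorem J_eq (hs : s ≠ 0) (h : IsM1Pair a b lam (x, s)) :
    J a b lam x = surf1 a b lam (s, H x) := by
  have hk := h.K_rel
  have hg := h.G_rel
  simp only at hk hg
  refine Prod.ext rfl (Prod.ext ?_ ?_)
  · simp only [J, surf1, pSq, rSq]
    field_simp
    linear_combination 16 * hk
  · simp only [J, surf1, pSq, rSq]
    field_simp
    linear_combination 8 * hg

theorem trace_eq (hs : s ≠ 0) (h : IsM1Pair a b lam (x, s)) :
    LinearMap.trace ℝ State (linearization a b lam (critCoeff lam s x) s 2 x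
      ∘ₗ linearization a b lam (critCoeff lam s x) s 2 x) = 2 * muSq a b lam s (H x) := by
  have ht := h.trace_rel
  simp only at ht
  simp only [muSq, pSq, rSq]
  field_simp
  linear_combination 2 * ht

end IsM1Pair

/-! ### The surfaces -/

theorem eventually_eval_ne_zero {P : Polynomial ℝ} (hP : P ≠ 0) (s : ℝ) :
    ∀ᶠ t in 𝓝[≠] s, P.eval t ≠ 0 := by
  have hfin : {t | P.IsRoot t}.Finite := Polynomial.finite_setOfPred_isRoot hP
  have := (hfin.subset (Set.sdiff_subset (t := {s}))).isClosed.isOpen_compl.mem_nhds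
    (x := s) (by simp)
  filter_upwards [mem_nhdsWithin_of_mem_nhds this, self_mem_nhdsWithin] with t h₁ h₂ h₃
  exact h₁ ⟨h₃, h₂⟩

theorem pSq_sq_sub_rSq_sq (a b : ℝ) : pSq a b ^ 2 - rSq a b ^ 2 = 4 * (a ^ 2 * b ^ 2) := by
  simp only [pSq, rSq]; ring

/-- The factor of the squared exponent that vanishes on the cuspidal edge. -/
def cuspFactor (a b lam : ℝ) (q : ℝ × ℝ) : ℝ :=
  12 * q.1 ^ 4 - 8 * (q.2 - lam ^ 2 / 2) * q.1 ^ 3 + pSq a b ^ 2 - rSq a b ^ 2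

/-- The factor of the squared exponent that vanishes on the tangency curve. -/
def tangencyFactor (a b lam : ℝ) (q : ℝ × ℝ) : ℝ :=
  2 * q.1 ^ 2 - 2 * (q.2 + lam ^ 2 / 2) * q.1 + pSq a b

theorem isClosed_cuspFactor (a b lam : ℝ) : IsClosed {q | cuspFactor a b lam q = 0} :=
  isClosed_eq (by unfold cuspFactor; fun_prop) continuous_const

theorem isClosed_tangencyFactor (a b lam : ℝ) : IsClosed {q | tangencyFactor a b lam q = 0} :=
  isClosed_eq (by unfold tangencyFactor; fun_prop) continuous_const

/-! ### The cuspidal edge -/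

section Section

variable (a b lam h : ℝ)

/-- The derivative in `s` of the coordinate `k` on the first surface. -/
def slope1 (t : ℝ) : ℝ :=
  6 * t - 4 * (h - lam ^ 2 / 2) + (pSq a b ^ 2 - rSq a b ^ 2) / (2 * t ^ 3)

theorem hasDerivAt_div_pow (c : ℝ) (n : ℕ) {t : ℝ} (ht : t ≠ 0) :
    HasDerivAt (fun u : ℝ => c / u ^ n) (-(n * c) / t ^ (n + 1)) t := by
  have := (hasDerivAt_zpow (-n : ℤ) t (Or.inl ht)).const_mul c
  refine (this.congr_of_eventuallyEq ?_).congr_deriv ?_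
  · exact Filter.Eventually.of_forall fun u => by simp [zpow_neg, div_eq_mul_inv]
  · have : (-n - 1 : ℤ) = -((n + 1 : ℕ) : ℤ) := by push_cast; ring
    rw [this, zpow_neg, zpow_natCast]; push_cast; field_simp

variable {t : ℝ}

/-- Along h = const the velocity is k_s · (1, −s/2), so the section is singular exactly where k_s =
0. -/
theorem hasDerivAt_section (ht : t ≠ 0) :
    HasDerivAt (fun u => (surf1 a b lam (u, h)).2)
      (slope1 a b lam h t, -(t / 2) * slope1 a b lam h t) t := by
  have e := hasDerivAt_id t
  have h₂ := hasDerivAt_div_pow ((pSq a b ^ 2 - rSq a b ^ 2) / 4) 2 ht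
  have h₁ := hasDerivAt_div_pow ((pSq a b ^ 2 - rSq a b ^ 2) / 4) 1 ht
  have hk := (((hasDerivAt_const t (pSq a b + (h - lam ^ 2 / 2) ^ 2)).sub
    (e.const_mul (4 * (h - lam ^ 2 / 2)))).add ((e.pow 2).const_mul 3)).sub h₂
  have hg := (((hasDerivAt_const t (h - lam ^ 2 / 2)).sub e).mul (e.pow 2)).add h₁
  refine ((hk.prodMk hg).congr_of_eventuallyEq ?_).congr_deriv ?_
  · exact Filter.Eventually.of_forall fun u => by
      simp [surf1, div_div]
  · simp only [slope1]
    ext <;> simp <;> field_simp <;> ring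

theorem hasDerivAt_slope1 (ht : t ≠ 0) :
    HasDerivAt (slope1 a b lam h) (6 - 3 * (pSq a b ^ 2 - rSq a b ^ 2) / (2 * t ^ 4)) t := by
  have h₃ := hasDerivAt_div_pow ((pSq a b ^ 2 - rSq a b ^ 2) / 2) 3 ht
  have := (((hasDerivAt_id t).const_mul 6).sub_const (4 * (h - lam ^ 2 / 2))).add h₃
  refine (this.congr_of_eventuallyEq ?_).congr_deriv ?_
  · exact Filter.Eventually.of_forall fun u => by
      simp [slope1, div_div]
  · simp; field_simp; ring

/-- The second derivative in `s` of the coordinate `k` on the first surface. -/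
def curv1 (t : ℝ) : ℝ := 6 - 3 * (pSq a b ^ 2 - rSq a b ^ 2) / (2 * t ^ 4)

theorem hasDerivAt_curv1 (ht : t ≠ 0) :
    HasDerivAt (curv1 a b) (6 * (pSq a b ^ 2 - rSq a b ^ 2) / t ^ 5) t := by
  have := (hasDerivAt_div_pow (3 * (pSq a b ^ 2 - rSq a b ^ 2) / 2) 4 ht).const_sub 6
  refine (this.congr_of_eventuallyEq ?_).congr_deriv ?_
  · exact Filter.Eventually.of_forall fun u => by
      simp [curv1, div_div]
  · field_simp; norm_num; ring

theorem eventually_deriv_section (ht : t ≠ 0) :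
    deriv (fun u => (surf1 a b lam (u, h)).2) =ᶠ[𝓝 t]
      fun u => (slope1 a b lam h u, -(u / 2) * slope1 a b lam h u) := by
  filter_upwards [isOpen_ne.mem_nhds ht] with u hu using (hasDerivAt_section a b lam h hu).deriv

theorem eventually_iteratedDeriv_section (ht : t ≠ 0) :
    iteratedDeriv 2 (fun u => (surf1 a b lam (u, h)).2) =ᶠ[𝓝 t]
      fun u => (curv1 a b u, -(1 / 2) * slope1 a b lam h u + -(u / 2) * curv1 a b u) := by
  filter_upwards [isOpen_ne.mem_nhds ht] with u hu
  rw [iteratedDeriv_succ, iteratedDeriv_one, (eventually_deriv_section a b lam h hu).deriv_eq]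
  have h₁ : HasDerivAt (slope1 a b lam h) (curv1 a b u) u := hasDerivAt_slope1 a b lam h hu
  exact (h₁.prodMk ((((hasDerivAt_id u).div_const 2).neg).mul h₁)).congr_deriv (by simp) |>.deriv

theorem iteratedDeriv_three_section (ht : t ≠ 0) :
    iteratedDeriv 3 (fun u => (surf1 a b lam (u, h)).2) t =
      (6 * (pSq a b ^ 2 - rSq a b ^ 2) / t ^ 5,
        -curv1 a b t - t / 2 * (6 * (pSq a b ^ 2 - rSq a b ^ 2) / t ^ 5)) := by
  rw [iteratedDeriv_succ, (eventually_iteratedDeriv_section a b lam h ht).deriv_eq]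
  have h₁ : HasDerivAt (slope1 a b lam h) (curv1 a b t) t := hasDerivAt_slope1 a b lam h ht
  have h₂ := hasDerivAt_curv1 a b ht
  refine ((h₂.prodMk ((h₁.const_mul (-(1 / 2))).add
    ((((hasDerivAt_id t).div_const 2).neg).mul h₂))).congr_deriv ?_).deriv
  ext <;> simp; ring

theorem linearIndependent_pair_iff (u v : ℝ × ℝ) :
    LinearIndependent ℝ ![u, v] ↔ u.1 * v.2 - u.2 * v.1 ≠ 0 := by
  rw [LinearIndependent.pair_iff]
  constructor
  · intro hl h0
    have h₁ := hl v.2 (-u.2) (by ext <;> simp <;> linarith)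
    have h₂ := hl v.1 (-u.1) (by ext <;> simp <;> linarith)
    have hu : u = 0 := by ext <;> simp <;> linarith [h₁.2, h₂.2]
    simpa using (hl 1 0 (by simp [hu])).1
  · intro hd x y hxy
    have e₁ : x * u.1 + y * v.1 = 0 := by simpa using congrArg Prod.fst hxy
    have e₂ : x * u.2 + y * v.2 = 0 := by simpa using congrArg Prod.snd hxy
    constructor
    · exact (mul_eq_zero.1 (show x * (u.1 * v.2 - u.2 * v.1) = 0 by
        linear_combination v.2 * e₁ - v.1 * e₂)).resolve_right hd
    · exact (mul_eq_zero.1 (show y * (u.1 * v.2 - u.2 * v.1) = 0 by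
        linear_combination u.1 * e₂ - u.2 * e₁)).resolve_right hd

theorem slope1_eq (ht : t ≠ 0) : slope1 a b lam h t = cuspFactor a b lam (t, h) / (2 * t ^ 3) := by
  simp only [slope1, cuspFactor]; field_simp; ring

theorem slope1_eq_zero_iff (ht : t ≠ 0) :
    slope1 a b lam h t = 0 ↔ cuspFactor a b lam (t, h) = 0 := by
  rw [slope1_eq a b lam h ht, div_eq_zero_iff, or_iff_left (by positivity)]

/-- Where k_s = 0, the determinant of the second and third derivatives equals −(k_ss)². -/
theorem hasCusp_iff (ht : t ≠ 0) : HasCusp (fun u => (surf1 a b lam (u, h)).2) t ↔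
    cuspFactor a b lam (t, h) = 0 ∧ curv1 a b t ≠ 0 := by
  rw [HasCusp, (hasDerivAt_section a b lam h ht).deriv, iteratedDeriv_three_section a b lam h ht,
    (eventually_iteratedDeriv_section a b lam h ht).eq_of_nhds, linearIndependent_pair_iff,
    ← slope1_eq_zero_iff a b lam h ht, Prod.mk_eq_zero]
  constructor
  · rintro ⟨⟨h₁, -⟩, h₂⟩
    refine ⟨h₁, fun h₃ => h₂ ?_⟩
    simp [h₁, h₃]
  · rintro ⟨h₁, h₂⟩
    refine ⟨⟨h₁, by simp [h₁]⟩, fun h₃ => pow_ne_zero 2 h₂ ?_⟩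
    simp only [h₁] at h₃
    linear_combination -h₃

end Section

theorem mem_cuspidalEdge1_iff {a b lam s h : ℝ} (hs : s ≠ 0) :
    (s, h) ∈ cuspidalEdge1 a b lam ↔ cuspFactor a b lam (s, h) = 0 := by
  constructor
  · refine fun hq => closure_minimal ?_ (isClosed_cuspFactor a b lam) hq
    rintro ⟨t, k⟩ ⟨ht, hc⟩
    exact ((hasCusp_iff a b lam k ht).1 hc).1
  · intro h0
    -- The factor is linear in h, so its zero set is a graph over s. Points with k_ss = 0, where t⁴
    -- = a²b², are isolated on it and belong to the closure.
    let φ : ℝ → ℝ := fun t => lam ^ 2 / 2 + (12 * t ^ 4 + pSq a b ^ 2 - rSq a b ^ 2) / (8 * t ^ 3)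
    have hφ : ContinuousAt φ s := by
      have : (8 : ℝ) * s ^ 3 ≠ 0 := by positivity
      exact ContinuousAt.add continuousAt_const (ContinuousAt.div (by fun_prop) (by fun_prop) this)
    have hφs : φ s = h := by
      simp only [cuspFactor] at h0
      simp only [φ]; field_simp; linear_combination 2 * h0
    have hlim : Filter.Tendsto (fun t => (t, φ t)) (𝓝[≠] s) (𝓝 (s, h)) := by
      rw [← hφs]
      exact (continuousAt_id.prodMk hφ).tendsto.mono_left nhdsWithin_le_nhds
    refine mem_closure_of_tendsto hlim ?_
    have hP : (Polynomial.X ^ 4 - Polynomial.C (a ^ 2 * b ^ 2) : Polynomial ℝ) ≠ 0 :=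
      Polynomial.X_pow_sub_C_ne_zero (by norm_num) _
    filter_upwards [eventually_eval_ne_zero hP s,
      mem_nhdsWithin_of_mem_nhds (isOpen_ne.mem_nhds hs)] with t h₁ (h₂ : t ≠ 0)
    refine ⟨h₂, (hasCusp_iff a b lam (φ t) h₂).2 ⟨?_, fun h₃ => h₁ ?_⟩⟩
    · simp only [cuspFactor, φ]; field_simp; ring
    · rw [curv1, pSq_sq_sub_rSq_sq] at h₃
      field_simp at h₃
      simp
      linear_combination h₃ / 12

/-! ### The tangency curve -/

/-- The linear map `(u, v) ↦ (v, κ u + m v, -(s / 2) κ u + n v)`. -/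
def surfDiff (s κ m n : ℝ) : ℝ × ℝ →L[ℝ] ℝ × ℝ × ℝ :=
  (ContinuousLinearMap.snd ℝ ℝ ℝ).prod
    ((κ • ContinuousLinearMap.fst ℝ ℝ ℝ + m • ContinuousLinearMap.snd ℝ ℝ ℝ).prod
      ((-(s / 2) * κ) • ContinuousLinearMap.fst ℝ ℝ ℝ + n • ContinuousLinearMap.snd ℝ ℝ ℝ))

theorem surfDiff_apply (s κ m n : ℝ) (v : ℝ × ℝ) :
    surfDiff s κ m n v = (v.2, κ * v.1 + m * v.2, -(s / 2) * κ * v.1 + n * v.2) := by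
  simp [surfDiff]

theorem injective_surfDiff_iff {s κ m n : ℝ} :
    Function.Injective (surfDiff s κ m n) ↔ κ ≠ 0 := by
  constructor
  · rintro hi rfl
    have := @hi (1, 0) 0 (by simp [surfDiff_apply])
    simp at this
  · intro hκ
    refine (injective_iff_map_eq_zero _).2 fun v hv => ?_
    simp only [surfDiff_apply, Prod.mk_eq_zero] at hv
    obtain ⟨h₁, h₂, -⟩ := hv
    simp only [h₁, mul_zero, add_zero, mul_eq_zero, hκ, false_or] at h₂
    exact Prod.ext h₂ h₁

/-- The combination 2g + sk eliminates κ, so a regular tangent plane depends only on s and 2n + sm.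
-/
theorem mem_range_surfDiff {s κ m n : ℝ} (hκ : κ ≠ 0) (w : ℝ × ℝ × ℝ) :
    w ∈ LinearMap.range (surfDiff s κ m n : ℝ × ℝ →ₗ[ℝ] ℝ × ℝ × ℝ) ↔
      2 * w.2.2 + s * w.2.1 = (2 * n + s * m) * w.1 := by
  constructor
  · rintro ⟨v, rfl⟩
    simp only [ContinuousLinearMap.coe_coe, surfDiff_apply]
    ring
  · intro h
    refine ⟨((w.2.1 - m * w.1) / κ, w.1), ?_⟩
    simp only [ContinuousLinearMap.coe_coe, surfDiff_apply]
    refine Prod.ext rfl (Prod.ext ?_ ?_)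
    · simp only; field_simp; ring
    · simp only; field_simp; linear_combination -h

theorem range_surfDiff_eq_iff {s κ m n s' κ' m' n' : ℝ} (hκ : κ ≠ 0) (hκ' : κ' ≠ 0) :
    LinearMap.range (surfDiff s κ m n : ℝ × ℝ →ₗ[ℝ] ℝ × ℝ × ℝ) =
        LinearMap.range (surfDiff s' κ' m' n' : ℝ × ℝ →ₗ[ℝ] ℝ × ℝ × ℝ) ↔
      s = s' ∧ 2 * n + s * m = 2 * n' + s' * m' := by
  constructor
  · intro h
    have e : ∀ w : ℝ × ℝ × ℝ, 2 * w.2.2 + s' * w.2.1 = (2 * n' + s' * m') * w.1 ↔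
        2 * w.2.2 + s * w.2.1 = (2 * n + s * m) * w.1 := fun w => by
      rw [← mem_range_surfDiff hκ' w, ← h, mem_range_surfDiff hκ w]
    -- Two vectors spanning the first plane are tested in the equation of the second.
    have e₁ := (e (0, 1, -(s / 2))).2 (by simp; ring)
    have e₂ := (e (1, 0, n + s * m / 2)).2 (by simp; ring)
    simp only at e₁ e₂
    exact ⟨by linarith, by linarith⟩
  · rintro ⟨rfl, h⟩
    ext w
    rw [mem_range_surfDiff hκ, mem_range_surfDiff hκ', h]

/-- The derivative in `s` of the coordinate `k` on the second surface. -/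
def slope2 (a b lam t : ℝ) : ℝ := 4 * lam ^ 2 - rSq a b ^ 2 / (2 * t ^ 3)

theorem hasFDerivAt_surf1 (a b lam : ℝ) {q : ℝ × ℝ} (hq : q.1 ≠ 0) :
    HasFDerivAt (surf1 a b lam) (surfDiff q.1 (slope1 a b lam q.2 q.1)
      (2 * (q.2 - lam ^ 2 / 2) - 4 * q.1) (q.1 ^ 2)) q := by
  have e := hasFDerivAt_fst (𝕜 := ℝ) (p := q)
  have f := (hasFDerivAt_snd (𝕜 := ℝ) (p := q)).sub_const (lam ^ 2 / 2)
  have h₂ := (hasDerivAt_div_pow ((pSq a b ^ 2 - rSq a b ^ 2) / 4) 2 hq).comp_hasFDerivAt q e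
  have h₁ := (hasDerivAt_div_pow ((pSq a b ^ 2 - rSq a b ^ 2) / 4) 1 hq).comp_hasFDerivAt q e
  have hk := (((f.pow 2).const_add (pSq a b)).sub ((f.const_mul 4).mul e)).add
    ((e.pow 2).const_mul 3) |>.sub h₂
  have hg := ((f.sub e).mul (e.pow 2)).add h₁
  refine (((hasFDerivAt_snd (𝕜 := ℝ) (p := q)).prodMk (hk.prodMk hg)).congr_of_eventuallyEq
    ?_).congr_fderiv ?_
  · exact Filter.Eventually.of_forall fun u => by simp [surf1, div_div]
  · refine ContinuousLinearMap.ext fun v => ?_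
    rw [surfDiff_apply]
    refine Prod.ext rfl (Prod.ext ?_ ?_)
    · simp [slope1]; field_simp; ring
    · simp [slope1]; field_simp; ring

theorem hasFDerivAt_surf2 (a b lam : ℝ) {q : ℝ × ℝ} (hq : q.1 ≠ 0) :
    HasFDerivAt (surf2 a b lam) (surfDiff q.1 (slope2 a b lam q.1)
      (-2 * lam ^ 2) (pSq a b / 2)) q := by
  have e := hasFDerivAt_fst (𝕜 := ℝ) (p := q)
  have f := hasFDerivAt_snd (𝕜 := ℝ) (p := q)
  have h₂ := (hasDerivAt_div_pow (rSq a b ^ 2 / 4) 2 hq).comp_hasFDerivAt q e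
  have h₁ := (hasDerivAt_div_pow (rSq a b ^ 2 / 4) 1 hq).comp_hasFDerivAt q e
  have hk := ((((f.sub_const (lam ^ 2 / 2)).sub (e.const_mul 2)).const_mul
    (-2 * lam ^ 2)).sub_const (lam ^ 4)).add h₂
  have hg := (((f.add_const (lam ^ 2 / 2)).const_mul (pSq a b / 2)).sub
    ((e.pow 2).const_mul (lam ^ 2))).sub h₁
  refine ((f.prodMk (hk.prodMk hg)).congr_of_eventuallyEq ?_).congr_fderiv ?_
  · exact Filter.Eventually.of_forall fun u => by
      simp [surf2, div_div]; ring
  · refine ContinuousLinearMap.ext fun v => ?_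
    rw [surfDiff_apply]
    refine Prod.ext rfl (Prod.ext ?_ ?_)
    · simp [slope2]; field_simp; ring
    · simp [slope2]; field_simp; ring

theorem surf2_eq_surf1 {a b lam : ℝ} {q : ℝ × ℝ} (hq : q.1 ≠ 0)
    (h : tangencyFactor a b lam q = 0) : surf2 a b lam q = surf1 a b lam q := by
  obtain ⟨t, k⟩ := q
  simp only at hq
  have hk : k = t + pSq a b / (2 * t) - lam ^ 2 / 2 := by
    simp only [tangencyFactor] at h
    field_simp; linear_combination -h
  subst hk
  refine Prod.ext rfl (Prod.ext ?_ ?_)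
  · simp only [surf1, surf2]; field_simp; ring
  · simp only [surf1, surf2]; field_simp; ring

theorem mem_tangencyCurve_iff {a b lam s h : ℝ} (hb : 0 < b) (hab : b < a) (hs : s ≠ 0) :
    (s, h) ∈ tangencyCurve a b lam ↔ tangencyFactor a b lam (s, h) = 0 := by
  have hr : rSq a b ≠ 0 := by simp only [rSq]; nlinarith
  constructor
  · refine fun hq => closure_minimal ?_ (isClosed_tangencyFactor a b lam) hq
    rintro q ⟨hq, q', hq', -, h₁, h₂, h₃⟩
    rw [(hasFDerivAt_surf1 a b lam hq).fderiv] at h₁ h₃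
    rw [(hasFDerivAt_surf2 a b lam hq').fderiv] at h₂ h₃
    -- Equal tangent planes force equal values of s on both surfaces, and the second invariant of
    -- the planes then gives the factor.
    obtain ⟨e, e'⟩ := (range_surfDiff_eq_iff (injective_surfDiff_iff.1 h₁)
      (injective_surfDiff_iff.1 h₂)).1 h₃
    rw [← e] at e'
    simp only [Set.mem_ofPred_eq, tangencyFactor]
    linear_combination -e'
  · intro h0
    let φ : ℝ → ℝ := fun t => t + pSq a b / (2 * t) - lam ^ 2 / 2
    have hφ : ContinuousAt φ s :=
      (continuousAt_id.add (ContinuousAt.div continuousAt_const (by fun_prop)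
        (mul_ne_zero two_ne_zero hs))).sub continuousAt_const
    have hφs : φ s = h := by
      simp only [tangencyFactor] at h0
      simp only [φ]; field_simp; linear_combination h0
    have hlim : Filter.Tendsto (fun t => (t, φ t)) (𝓝[≠] s) (𝓝 (s, h)) := by
      rw [← hφs]
      exact (continuousAt_id.prodMk hφ).tendsto.mono_left nhdsWithin_le_nhds
    refine mem_closure_of_tendsto hlim ?_
    -- Up to nonzero factors P and Q are k_s on Π₁ and Π₂ along h = φ(t). Off their roots both
    -- surfaces are regular. Q is nonzero even for λ = 0, because a ≠ b.
    open Polynomial in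
    let P : ℝ[X] := 4 * X ^ 4 + C (8 * lam ^ 2) * X ^ 3 - C (4 * pSq a b) * X ^ 2
      + C (4 * (a ^ 2 * b ^ 2))
    open Polynomial in
    let Q : ℝ[X] := C (8 * lam ^ 2) * X ^ 3 - C (rSq a b ^ 2)
    have hP : P ≠ 0 := by
      intro h
      have := congrArg (Polynomial.eval 0) h
      simp [P] at this
      rcases this with h | h <;> linarith
    have hQ : Q ≠ 0 := by
      intro h
      have := congrArg (Polynomial.eval 0) h
      simp [Q, hr] at this
    filter_upwards [eventually_eval_ne_zero hP s, eventually_eval_ne_zero hQ s,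
      mem_nhdsWithin_of_mem_nhds (isOpen_ne.mem_nhds hs)] with t h₁ h₂ (ht : t ≠ 0)
    have ht' : tangencyFactor a b lam (t, φ t) = 0 := by
      simp only [tangencyFactor, φ]; field_simp; ring
    have e₁ : slope1 a b lam (φ t) t ≠ 0 := by
      intro h
      rw [slope1_eq_zero_iff a b lam _ ht, cuspFactor, add_sub_assoc, pSq_sq_sub_rSq_sq] at h
      refine h₁ ?_
      simp [P]
      rw [← h]
      simp only [φ]; field_simp; ring
    have e₂ : slope2 a b lam t ≠ 0 := by
      intro h
      refine h₂ ?_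
      simp [Q]
      simp only [slope2] at h
      field_simp at h
      linear_combination h
    -- The surfaces touch at equal parameters (s, h).
    refine ⟨ht, (t, φ t), ht, surf2_eq_surf1 ht ht', ?_⟩
    rw [(hasFDerivAt_surf1 a b lam (q := (t, φ t)) ht).fderiv,
      (hasFDerivAt_surf2 a b lam (q := (t, φ t)) ht).fderiv]
    refine ⟨injective_surfDiff_iff.2 e₁, injective_surfDiff_iff.2 e₂,
      (range_surfDiff_eq_iff e₁ e₂).2 ⟨rfl, ?_⟩⟩
    simp only [tangencyFactor] at ht'
    simp only
    linear_combination -ht'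

theorem muSq_eq_zero_iff {a b lam s h : ℝ} (hb : 0 < b) (hab : b < a) (hs : s ≠ 0) :
    muSq a b lam s h = 0 ↔ (s, h) ∈ cuspidalEdge1 a b lam ∪ tangencyCurve a b lam := by
  rw [Set.mem_union, mem_cuspidalEdge1_iff hs, mem_tangencyCurve_iff hb hab hs,
    muSq, mul_eq_zero, mul_eq_zero, cuspFactor, tangencyFactor,
    or_iff_right (one_div_ne_zero (mul_ne_zero two_ne_zero hs))]

end KowalevskiGyrostat

end
-- Assembly of the theorem.
theorem mainTheorem1 (a b lam : ℝ) (hb : 0 < b) (hab : b < a) :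
    (∀ x ∈ KowalevskiGyrostat.M1 a b lam, KowalevskiGyrostat.rank a b lam x = 2 →
      ∃ s : ℝ, s ≠ 0 ∧ KowalevskiGyrostat.IsS1Value a b lam x s ∧
        KowalevskiGyrostat.J a b lam x =
          KowalevskiGyrostat.surf1 a b lam (s, KowalevskiGyrostat.H x) ∧
        (∃ cH cK : ℝ, KowalevskiGyrostat.HasSquaredExponent lam
          (KowalevskiGyrostat.integral a b lam cH cK 2) x
          (KowalevskiGyrostat.muSq a b lam s (KowalevskiGyrostat.H x))) ∧
        (KowalevskiGyrostat.IsCenter a b lam x ↔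
          KowalevskiGyrostat.muSq a b lam s (KowalevskiGyrostat.H x) < 0) ∧
        (KowalevskiGyrostat.IsSaddle a b lam x ↔
          0 < KowalevskiGyrostat.muSq a b lam s (KowalevskiGyrostat.H x)) ∧
        (KowalevskiGyrostat.IsDegenerate a b lam x ↔
          KowalevskiGyrostat.muSq a b lam s (KowalevskiGyrostat.H x) = 0) ∧
        (KowalevskiGyrostat.IsDegenerate a b lam x ↔
          (s, KowalevskiGyrostat.H x) ∈ KowalevskiGyrostat.cuspidalEdge1 a b lam ∪
            KowalevskiGyrostat.tangencyCurve a b lam)) ∧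
    (∀ s h : ℝ, s ≠ 0 →
      (KowalevskiGyrostat.muSq a b lam s h = 0 ↔
        (s, h) ∈ KowalevskiGyrostat.cuspidalEdge1 a b lam ∪
          KowalevskiGyrostat.tangencyCurve a b lam)) := by
  have ha := hb.trans hab
  refine ⟨fun x hx hr => ?_, fun s h hs => KowalevskiGyrostat.muSq_eq_zero_iff hb hab hs⟩
  obtain ⟨s, hlim, hp⟩ := KowalevskiGyrostat.exists_S1Value ha hb hx hr
  have hs := hp.ne_zero ha hb
  have hcrit := hp.tangent_critical ha hb
  have hm := hp.trace_eq hs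
  obtain ⟨h₁, h₂, h₃⟩ := KowalevskiGyrostat.types_of_rank_two ha hb hp.mem hr hcrit hm
  exact ⟨s, hs, hlim, hp.J_eq hs,
    ⟨_, _, (KowalevskiGyrostat.exponents_of_rank_two ha hb hp.mem hr hcrit hm).1⟩, h₁, h₂, h₃,
    h₃.trans (KowalevskiGyrostat.muSq_eq_zero_iff hb hab hs)⟩
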